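/- Let $X$ be a real Banach space, $t_0<T$, $F:[t_0,T]\times X\to X$, and let $u:[t_0,T]\to X$ solve $u'(t)=F(t,u(t))$, $u(t_0)=u_0$. Assume that, for some $K\ge 2$, $u$ is $C^K$ and that in a strip $\{(t,x):t\in[t_0,T],\ \|x-u(t)\|<\rho\}$, $\rho>0$, $F$ is $K$ times continuously Fréchet differentiable with all derivatives up to order $K$ uniformly bounded (the Jacobian $\partial F/\partial u(t,x)$ is then a bounded operator and generates the strongly continuous semigroup $e^{\tau\,\partial F/\partial u(t,x)}$, $\tau\ge0$). For $(t_n,v)$ put $J=\frac{\partial F}{\partial u}(t_n,v)$, $V=\frac{\partial F}{\partial t}(t_n,v)$, $N(t,x)=F(t,x)-Jx-tV$, and let $\varphi_k(Z)=\int_0^1 e^{(1-\theta)Z}\frac{\theta^{k-1}}{(k-1)!}\,d\theta$, $k\ge1$. *Exponential Rosenbrock (ExpRB) method.* Let $s$ be the number of stages, $c_i\in(0,1]$ ($2\le i\le s$), $a_{ij}(Z)=\sum_{k=1}^{\ell_{ij}}\alpha_{ij}^{(k)}\varphi_k(c_iZ)$, $b_i(Z)=\sum_{k=1}^{m_i}\beta_i^{(k)}\varphi_k(Z)$.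 With $t_n=t_0+nH$, one step with $v=u_n$ reads $$U_{ni}=u_n+c_iH\varphi_1(c_iHJ)F(t_n,u_n)+c_i^2H^2\varphi_2(c_iHJ)V+H\sum_{j=2}^{i-1}a_{ij}(HJ)D_{nj}\quad(2\le i\le s),$$ $$u_{n+1}=u_n+H\varphi_1(HJ)F(t_n,u_n)+H^2\varphi_2(HJ)V+H\sum_{i=2}^{s}b_i(HJ)D_{ni},$$ where $D_{ni}=N(t_n+c_iH,U_{ni})-N(t_n,u_n)$. Assume that it converges with global order $p\ge1$, that is, $\|u_n-u(t_n)\|\le CH^p$ for all sufficiently small $H>0$ and all $n\ge 0$ with $t_n\le T$, with $C$ independent of $n$ and $H$. *Multirate (MERB) method.* Let $m\ge1$ be an integer, $h=H/m$ and $\hat u_0=u_0$. In the step from $t_n$ to $t_{n+1}\le T$ take $J,V,N$ at $(t_n,\hat u_n)$ (denoted $\hat J_n,\hat V_n,\hat N_n$) and $\hat D_{nj}=\hat N_n(t_n+c_jH,\hat U_{nj})-\hat N_n(t_n,\hat u_n)$. For $i=2,\dots,s$, $\hat U_{ni}$ is computed by a one-step solver applied on $[0,c_iH]$ to $$y'=\hat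 J_ny+\hat N_n(t_n,\hat u_n)+(t_n+\tau)\hat V_n+\sum_{j=2}^{i-1}\Big(\sum_{k=1}^{\ell_{ij}}\frac{\alpha_{ij}^{(k)}}{c_i^kH^{k-1}(k-1)!}\tau^{k-1}\Big)\hat D_{nj},\qquad y(0)=\hat u_n,$$ and then $\hat u_{n+1}$ by a one-step solver applied on $[0,H]$ to $$y'=\hat J_ny+\hat N_n(t_n,\hat u_n)+(t_n+\tau)\hat V_n+\sum_{i=2}^{s}\Big(\sum_{k=1}^{m_i}\frac{\beta_{i}^{(k)}}{H^{k-1}(k-1)!}\tau^{k-1}\Big)\hat D_{ni},\qquad y(0)=\hat u_n,$$ using micro steps of size at most $h$. Assume that in these integrations the solvers have orders $q\ge0$ (stages) and $r\ge1$ (update) with error constants $\kappa_q,\kappa_r$: in every micro step, of size $k$ say, the new approximation differs from the value of the exact solution of the fast equation through the previous approximation by at most $\kappa_qk^{q+1}$, respectively $\kappa_rk^{r+1}$, where $\kappa_q,\kappa_r$ do not depend on $n$, $H$ and $m$. Then there is a constant $C_1$, depending neither on the solvers nor on $\kappa_q,\kappa_r$, and, given $\kappa_q,\kappa_r$, there are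 constants $C_2,C_3$ and $H_0>0$ such that for all $0<H\le H_0$, all $m\ge1$, all such solvers and all $n\ge 0$ with $t_n=t_0+nH\le T$, $$\|\hat u_n-u(t_n)\|\le C_1H^p+C_2\,H\,h^q+C_3\,h^r .$$ In particular, if $q\ge p-1$ and $r\ge p$, then, given $\kappa_q,\kappa_r$, there are $C$ and $H_0>0$ such that $\|\hat u_n-u(t_n)\|\le CH^p$ for all such $H$, $m$, solvers and $n$. -/

import Mathlib

open Set

noncomputable section

/-! ## The initial value problem -/

/-- The data of an initial value problem `u'(t) = F(t, u(t))`, `u(t₀) = u₀`, on `[t₀, T]`.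
Only the values `F t x` with `t ∈ [t₀, T]` matter. -/
structure IVP (X : Type*) where
  t₀ : ℝ
  T : ℝ
  u₀ : X
  F : ℝ → X → X

namespace IVP

section
variable {X : Type*} [NormedAddCommGroup X] [NormedSpace ℝ X] (P : IVP X)

/-- `u` is a (classical) solution of the initial value problem on `[t₀, T]`. -/
structure IsSolution (u : ℝ → X) : Prop where
  init : u P.t₀ = P.u₀
  ode : ∀ t ∈ Icc P.t₀ P.T, HasDerivWithinAt u (P.F t (u t)) (Icc P.t₀ P.T) t

/-- The strip of radius `ρ` along `u`. -/
def strip (u : ℝ → X) (ρ : ℝ) : Set (ℝ × X) :=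
  {z | z.1 ∈ Icc P.t₀ P.T ∧ ‖z.2 - u z.1‖ < ρ}

/-- Smoothness assumption of order `K`: `u` is of class `C^K` on `[t₀, T]`, and in some strip along
`u` the map `F` is of class `C^K` in the sense of Fréchet, jointly in `(t, x)`, with all derivatives
of order at most `K` uniformly bounded. (The derivatives of `u` are bounded by compactness.) -/
structure IsSmoothAlong (u : ℝ → X) (K : ℕ) : Prop where
  sol : ContDiffOn ℝ K u (Icc P.t₀ P.T)
  rhs : ∃ ρ > 0, ContDiffOn ℝ K (fun z : ℝ × X => P.F z.1 z.2) (P.strip u ρ) ∧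
    ∀ k ≤ K, ∃ M : ℝ, ∀ z ∈ P.strip u ρ,
      ‖iteratedFDerivWithin ℝ k (fun z : ℝ × X => P.F z.1 z.2) (P.strip u ρ) z‖ ≤ M

/-- The Jacobian `J = ∂F/∂u (t, x)`. -/
def jac (t : ℝ) (x : X) : X →L[ℝ] X := fderiv ℝ (P.F t) x

/-- The time derivative `V = ∂F/∂t (t, x)` (one-sided at the end points of `[t₀, T]`). -/
def dt (t : ℝ) (x : X) : X := derivWithin (fun τ => P.F τ x) (Icc P.t₀ P.T) t

/-- The nonlinear remainder `N (t, x) = F(t, x) - J x - t V`, where `J`, `V` are the partial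
derivatives of `F` at the point `(tn, v)`. -/
def rem (tn : ℝ) (v : X) (t : ℝ) (x : X) : X :=
  P.F t x - P.jac tn v x - t • P.dt tn v

end

end IVP

/-! ## Semigroups and `φ`-functions -/

/-- Strongly continuous semigroups of bounded operators. -/
structure IsStronglyContinuousSemigroup {X : Type*} [NormedAddCommGroup X] [NormedSpace ℝ X]
    (S : ℝ → X →L[ℝ] X) : Prop where
  zero : S 0 = 1
  add : ∀ s t : ℝ, 0 ≤ s → 0 ≤ t → S (s + t) = S s * S t
  cont : ∀ x : X, ContinuousOn (fun t => S t x) (Ici 0)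

/-- The everywhere defined operator `A` is the generator of `S`. -/
def IsGeneratorOf {X : Type*} [NormedAddCommGroup X] [NormedSpace ℝ X]
    (A : X →L[ℝ] X) (S : ℝ → X →L[ℝ] X) : Prop :=
  ∀ x : X, HasDerivWithinAt (fun t => S t x) (A x) (Ici 0) 0

/-- The Jacobian of a Fréchet differentiable `F` is a bounded operator on `X`. It therefore always
generates a strongly continuous semigroup, namely `exp (t J)`, so that this needs no separate
hypothesis. -/
theorem IVP.jac_generates {X : Type*} [NormedAddCommGroup X] [NormedSpace ℝ X] [CompleteSpace X]
    (P : IVP X) (t : ℝ) (x : X) :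
    IsStronglyContinuousSemigroup (fun σ : ℝ => NormedSpace.exp (σ • P.jac t x)) ∧
      IsGeneratorOf (P.jac t x) (fun σ : ℝ => NormedSpace.exp (σ • P.jac t x)) := by
  generalize P.jac t x = A
  have hd : ∀ σ : ℝ, HasDerivAt (fun σ : ℝ => NormedSpace.exp (σ • A))
      (NormedSpace.exp (σ • A) * A) σ := fun σ => hasDerivAt_exp_smul_const A σ
  have hx : ∀ (y : X) (σ : ℝ), HasDerivAt (fun σ : ℝ => NormedSpace.exp (σ • A) y)
      ((NormedSpace.exp (σ • A) * A) y) σ := fun y σ => by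
    simpa using (hd σ).clm_apply (hasDerivAt_const σ y)
  refine ⟨⟨by simp, fun s r _ _ => ?_, fun y σ _ => (hx y σ).continuousAt.continuousWithinAt⟩,
    fun y => by simpa using (hx y 0).hasDerivWithinAt⟩
  simp only [add_smul]
  let _ : NormedAlgebra ℚ (X →L[ℝ] X) := NormedAlgebra.restrictScalars ℚ ℝ (X →L[ℝ] X)
  exact NormedSpace.exp_add_of_commute (((Commute.refl A).smul_left s).smul_right r)

/-- `φ_k (Z) = ∫_0^1 exp ((1 - θ) Z) θ^(k-1) / (k-1)! dθ` for `k ≥ 1`. -/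
def phi {X : Type*} [NormedAddCommGroup X] [NormedSpace ℝ X] (k : ℕ) (Z : X →L[ℝ] X) :
    X →L[ℝ] X :=
  ∫ θ in (0 : ℝ)..1, (θ ^ (k - 1) / ((k - 1).factorial : ℝ)) • NormedSpace.exp ((1 - θ) • Z)

/-! ## Exponential Rosenbrock methods -/

/-- The coefficients of an explicit `s`-stage exponential Rosenbrock method whose weights
`a i j (Z) = ∑_{k=1}^{ℓ i j} α i j k φ_k (c i Z)` and `b i (Z) = ∑_{k=1}^{μ i} β i k φ_k (Z)` are
linear combinations of `φ`-functions. Indices are as usual `2 ≤ j < i ≤ s`; the first stage has the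
node `0` and does not enter. -/
structure ExpRB where
  s : ℕ
  c : ℕ → ℝ
  ℓ : ℕ → ℕ → ℕ
  α : ℕ → ℕ → ℕ → ℝ
  μ : ℕ → ℕ
  β : ℕ → ℕ → ℝ
  c_pos : ∀ i ∈ Finset.Icc 2 s, 0 < c i
  c_le_one : ∀ i ∈ Finset.Icc 2 s, c i ≤ 1

namespace ExpRB

section
variable {X : Type*} [NormedAddCommGroup X] [NormedSpace ℝ X] (M : ExpRB) (P : IVP X)

/-- The weight `a i j (Z)`. -/
def a (i j : ℕ) (Z : X →L[ℝ] X) : X →L[ℝ] X :=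
  ∑ k ∈ Finset.Icc 1 (M.ℓ i j), M.α i j k • phi k (M.c i • Z)

/-- The weight `b i (Z)`. -/
def b (i : ℕ) (Z : X →L[ℝ] X) : X →L[ℝ] X :=
  ∑ k ∈ Finset.Icc 1 (M.μ i), M.β i k • phi k Z

/-- The difference `D j = N (t + c j H, x) - N (t, v)`, where `N` is the remainder of the
linearization at `(t, v)` and `x` is the value of the `j`-th stage. -/
def diff (H t : ℝ) (v : X) (j : ℕ) (x : X) : X :=
  P.rem t v (t + M.c j * H) x - P.rem t v t v

/-- The internal stages `U i`, `2 ≤ i ≤ s`, of one step of size `H` from `(t, v)`. -/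
def stage (H t : ℝ) (v : X) (i : ℕ) : X :=
  v + (M.c i * H) • phi 1 ((M.c i * H) • P.jac t v) (P.F t v)
    + (M.c i ^ 2 * H ^ 2) • phi 2 ((M.c i * H) • P.jac t v) (P.dt t v)
    + H • ∑ j ∈ (Finset.Ico 2 i).attach,
        M.a i j.1 (H • P.jac t v) (M.diff P H t v j.1 (stage H t v j.1))
termination_by i
decreasing_by exact (Finset.mem_Ico.1 j.2).2

/-- One step of size `H` of the exponential Rosenbrock method from `(t, v)`. -/
def step (H t : ℝ) (v : X) : X :=
  v + H • phi 1 (H • P.jac t v) (P.F t v) + H ^ 2 • phi 2 (H • P.jac t v) (P.dt t v)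
    + H • ∑ i ∈ Finset.Icc 2 M.s,
        M.b i (H • P.jac t v) (M.diff P H t v i (M.stage P H t v i))

/-- The numerical solution `u_n ≈ u (t₀ + n H)` of the exponential Rosenbrock method. -/
def solution (H : ℝ) : ℕ → X
  | 0 => P.u₀
  | n + 1 => M.step P H (P.t₀ + n * H) (solution H n)

/-- The exponential Rosenbrock method converges with global order `p` to the solution `u`. -/
def HasGlobalOrder (u : ℝ → X) (p : ℕ) : Prop :=
  ∃ C H₀ : ℝ, 0 < H₀ ∧ ∀ H : ℝ, 0 < H → H ≤ H₀ → ∀ n : ℕ, P.t₀ + n * H ≤ P.T →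
    ‖M.solution P H n - u (P.t₀ + n * H)‖ ≤ C * H ^ p

/-! ## The right-hand sides of the fast equations -/

/-- The polynomial `p̂_{ni}(τ)`, where `v` stands for `û_n` and `U j` for the computed stages. -/
def stagePoly (H t : ℝ) (v : X) (U : ℕ → X) (i : ℕ) (τ : ℝ) : X :=
  P.rem t v t v + (t + τ) • P.dt t v
    + ∑ j ∈ Finset.Ico 2 i,
        (∑ k ∈ Finset.Icc 1 (M.ℓ i j),
          M.α i j k / (M.c i ^ k * H ^ (k - 1) * ((k - 1).factorial : ℝ)) * τ ^ (k - 1)) •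
          M.diff P H t v j (U j)

/-- The polynomial `q̂_n(τ)`. -/
def finalPoly (H t : ℝ) (v : X) (U : ℕ → X) (τ : ℝ) : X :=
  P.rem t v t v + (t + τ) • P.dt t v
    + ∑ i ∈ Finset.Icc 2 M.s,
        (∑ k ∈ Finset.Icc 1 (M.μ i),
          M.β i k / (H ^ (k - 1) * ((k - 1).factorial : ℝ)) * τ ^ (k - 1)) •
          M.diff P H t v i (U i)

/-- The right-hand side `Ĵ_n y + p̂_{ni}(τ)` of the fast equation of the `i`-th stage. -/
def stageRHS (H t : ℝ) (v : X) (U : ℕ → X) (i : ℕ) (τ : ℝ) (y : X) : X :=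
  P.jac t v y + M.stagePoly P H t v U i τ

/-- The right-hand side `Ĵ_n y + q̂_n(τ)` of the fast equation of the update. -/
def finalRHS (H t : ℝ) (v : X) (U : ℕ → X) (τ : ℝ) (y : X) : X :=
  P.jac t v y + M.finalPoly P H t v U τ

end

end ExpRB

/-! ## Fast solvers -/

/-- A one-step solver: `Ψ f τ k y` is the result of one step of size `k` from `(τ, y)` for the
equation `y' = f(τ, y)`. -/
abbrev Solver (X : Type*) := (ℝ → X → X) → ℝ → ℝ → X → X

/-- A finite grid together with the approximations computed at its points. -/
structure Micro (X : Type*) where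
  N : ℕ
  τ : ℕ → ℝ
  y : ℕ → X

namespace Micro

section
variable {X : Type*} [NormedAddCommGroup X] [NormedSpace ℝ X]

/-- `R` is the result of integrating `y' = f(τ, y)`, `y(0) = y₀`, over `[0, S]` by the solver `Ψ`
with micro time step `h`. As `S` need not be a multiple of `h`, the grid may have any step sizes
up to `h`. -/
structure IsRun (R : Micro X) (Ψ : Solver X) (f : ℝ → X → X) (S h : ℝ) (y₀ : X) : Prop where
  start : R.τ 0 = 0
  stop_at : R.τ R.N = S
  lt : ∀ j < R.N, R.τ j < R.τ (j + 1)
  le : ∀ j < R.N, R.τ (j + 1) - R.τ j ≤ h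
  init : R.y 0 = y₀
  next : ∀ j < R.N, R.y (j + 1) = Ψ f (R.τ j) (R.τ (j + 1) - R.τ j) (R.y j)

/-- The solver is of order `q` with error constant `K` in the integration `R` of `y' = f(τ, y)`:
in a step of size `k`, the new approximation differs by at most `K k^(q+1)` from the value of the
exact solution that starts at the previous approximation. -/
def HasOrder (R : Micro X) (f : ℝ → X → X) (q : ℕ) (K : ℝ) : Prop :=
  ∀ j < R.N, ∀ z : ℝ → X, z (R.τ j) = R.y j →
    (∀ σ ∈ Icc (R.τ j) (R.τ (j + 1)),
      HasDerivWithinAt z (f σ (z σ)) (Icc (R.τ j) (R.τ (j + 1))) σ) →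
    ‖R.y (j + 1) - z (R.τ (j + 1))‖ ≤ K * (R.τ (j + 1) - R.τ j) ^ (q + 1)

end

end Micro

/-! ## Multirate exponential Rosenbrock methods -/

/-- A computation with the MERB method built from the ExpRB method `M`, with macro time step `H` and
micro time step `h`. The fast equation of the `i`-th stage is integrated over `[0, c i H]` by the
solver `Ψ i`, that of the update over `[0, H]` by the solver `Φ`. Here `u n` stands for `û_n`,
`U n i` for `Û_{ni}`, and `stageRun n i`, `finalRun n` are the fast integrations. -/
structure MERB {X : Type*} [NormedAddCommGroup X] [NormedSpace ℝ X] (M : ExpRB) (P : IVP X)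
    (Ψ : ℕ → Solver X) (Φ : Solver X) (H h : ℝ) where
  u : ℕ → X
  U : ℕ → ℕ → X
  stageRun : ℕ → ℕ → Micro X
  finalRun : ℕ → Micro X
  init : u 0 = P.u₀
  isRun_stage : ∀ n : ℕ, P.t₀ + (n + 1) * H ≤ P.T → ∀ i ∈ Finset.Icc 2 M.s,
    (stageRun n i).IsRun (Ψ i) (M.stageRHS P H (P.t₀ + n * H) (u n) (U n) i) (M.c i * H) h (u n)
  stage_eq : ∀ n : ℕ, P.t₀ + (n + 1) * H ≤ P.T → ∀ i ∈ Finset.Icc 2 M.s,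
    U n i = (stageRun n i).y (stageRun n i).N
  isRun_final : ∀ n : ℕ, P.t₀ + (n + 1) * H ≤ P.T →
    (finalRun n).IsRun Φ (M.finalRHS P H (P.t₀ + n * H) (u n) (U n)) H h (u n)
  final_eq : ∀ n : ℕ, P.t₀ + (n + 1) * H ≤ P.T →
    u (n + 1) = (finalRun n).y (finalRun n).N

namespace MERB

section
variable {X : Type*} [NormedAddCommGroup X] [NormedSpace ℝ X] {M : ExpRB} {P : IVP X}
  {Ψ : ℕ → Solver X} {Φ : Solver X} {H h : ℝ}

/-- The solvers of the stage equations are of order `q` with error constant `K`. -/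
def StageOrder (R : MERB M P Ψ Φ H h) (q : ℕ) (K : ℝ) : Prop :=
  ∀ n : ℕ, P.t₀ + (n + 1) * H ≤ P.T → ∀ i ∈ Finset.Icc 2 M.s,
    (R.stageRun n i).HasOrder (M.stageRHS P H (P.t₀ + n * H) (R.u n) (R.U n) i) q K

/-- The solver of the update equation is of order `r` with error constant `K`. -/
def FinalOrder (R : MERB M P Ψ Φ H h) (r : ℕ) (K : ℝ) : Prop :=
  ∀ n : ℕ, P.t₀ + (n + 1) * H ≤ P.T →
    (R.finalRun n).HasOrder (M.finalRHS P H (P.t₀ + n * H) (R.u n) (R.U n)) r K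

end

end MERB

end

/-! Each fast equation is linear with constant operator `J` and polynomial forcing. Since `τ ^ k •
phi k (τ • J)` solves `W' = J W + τ ^ (k - 1) / (k - 1)!`, its exact solution at the end of the
interval is the corresponding exponential Rosenbrock formula, evaluated at the computed stages
(`hasDerivAt_fastSolution`, `fastSolution_eq_add_fastIncrement`). A multirate step is therefore a
Rosenbrock step with defects only: the micro errors add up to `O(H h ^ q)` in each stage and `O(H h
^ r)` in the update (`Micro.IsRun.norm_sub_le`).

One Rosenbrock step is stable: it expands distances by at most `1 + L H`, and stage defects enter
with a further factor `L H` (`ExpRB.norm_updateMap_sub_le`). A discrete Gronwall argument bounds the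
distance of the two numerical solutions by a multiple of `H h ^ q + h ^ r`
(`MERB.norm_sub_solution_le`). The assumed convergence supplies `C₁ H ^ p`, so no order conditions
are needed and `C₁` does not see the solvers.

The estimates hold only in a strip along `u`, so the induction must also keep both numerical
solutions and all stages inside it. Small `H` achieves this uniformly in `m`, because `h ≤ H`, `p ≥
1` and `r ≥ 1`. -/

open Filter Topology

/-! ### Exponentials and `φ`-functions of small operators -/

section Phi
variable {X : Type*} [NormedAddCommGroup X] [NormedSpace ℝ X] [CompleteSpace X]

/-- Near the origin the exponential is bounded and Lipschitz continuous with constant `2`. -/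
theorem exists_exp_lipschitz_ball (X : Type*) [NormedAddCommGroup X] [NormedSpace ℝ X]
    [CompleteSpace X] :
    ∃ δ > 0, ∀ A B : X →L[ℝ] X, ‖A‖ < δ → ‖B‖ < δ →
      ‖NormedSpace.exp A‖ ≤ 2 ∧ ‖NormedSpace.exp A - NormedSpace.exp B‖ ≤ 2 * ‖A - B‖ := by
  have h : HasStrictFDerivAt (NormedSpace.exp : (X →L[ℝ] X) → (X →L[ℝ] X))
      (1 : (X →L[ℝ] X) →L[ℝ] (X →L[ℝ] X)) 0 := hasStrictFDerivAt_exp_zero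
  -- The strict derivative of `exp` at `0` is the identity, of norm at most `1`; any Lipschitz
  -- constant above `1` is thus available near `0`.
  obtain ⟨s, hs, hL⟩ := h.exists_lipschitzOnWith_of_nnnorm_lt 2
    ((ContinuousLinearMap.norm_id_le : ‖(1 : (X →L[ℝ] X) →L[ℝ] (X →L[ℝ] X))‖ ≤ 1).trans_lt
      (by norm_num : (1 : ℝ) < 2))
  obtain ⟨ε, hε, hb⟩ := Metric.mem_nhds_iff.1 hs
  have key : ∀ A B : X →L[ℝ] X, ‖A‖ < ε → ‖B‖ < ε →
      ‖NormedSpace.exp A - NormedSpace.exp B‖ ≤ 2 * ‖A - B‖ := fun A B hA hB => by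
    simpa using hL.norm_sub_le (hb (by simpa using hA)) (hb (by simpa using hB))
  refine ⟨min ε (1 / 2), by positivity, fun A B hA hB => ⟨?_, key A B
    (hA.trans_le (min_le_left _ _)) (hB.trans_le (min_le_left _ _))⟩⟩
  have h1 := key A 0 (hA.trans_le (min_le_left _ _)) (by simpa using hε)
  have h2 : ‖A‖ < 1 / 2 := hA.trans_le (min_le_right _ _)
  have h3 : ‖(1 : X →L[ℝ] X)‖ ≤ 1 := ContinuousLinearMap.norm_id_le
  have h4 := norm_add_le (NormedSpace.exp A - 1) (1 : X →L[ℝ] X)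
  simp only [NormedSpace.exp_zero, sub_zero, sub_add_cancel] at h1 h4
  linarith

theorem continuous_exp_smul {g : ℝ → ℝ} (hg : Continuous g) (Z : X →L[ℝ] X) :
    Continuous fun θ : ℝ => NormedSpace.exp (g θ • Z) :=
  (continuous_iff_continuousAt.2 fun θ => (hasDerivAt_exp_smul_const Z θ).continuousAt).comp hg

theorem continuous_phi_integrand (k : ℕ) (Z : X →L[ℝ] X) :
    Continuous fun θ : ℝ =>
      (θ ^ (k - 1) / ((k - 1).factorial : ℝ)) • NormedSpace.exp ((1 - θ) • Z) :=
  by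
    refine Continuous.smul (M := ℝ) ?_ (continuous_exp_smul ?_ Z) <;> fun_prop

theorem norm_pow_div_factorial_le_one (k : ℕ) {θ : ℝ} (hθ : θ ∈ Ioc (0 : ℝ) 1) :
    ‖θ ^ k / (k.factorial : ℝ)‖ ≤ 1 := by
  have h0 : 0 ≤ θ := hθ.1.le
  rw [Real.norm_of_nonneg (by positivity)]
  exact div_le_one_of_le₀ ((pow_le_one₀ h0 hθ.2).trans
    (by exact_mod_cast Nat.one_le_iff_ne_zero.2 k.factorial_ne_zero)) (by positivity)

omit [CompleteSpace X] in
theorem norm_one_sub_smul_lt {δ : ℝ} {Z : X →L[ℝ] X} (hZ : ‖Z‖ < δ) {θ : ℝ}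
    (hθ : θ ∈ Ioc (0 : ℝ) 1) : ‖(1 - θ) • Z‖ < δ := by
  rw [norm_smul, Real.norm_of_nonneg (by linarith [hθ.2])]
  exact (mul_le_of_le_one_left (norm_nonneg _) (by linarith [hθ.1])).trans_lt hZ

/-- Near the origin all `φ`-functions are bounded and Lipschitz continuous with constant `2`. -/
theorem exists_phi_lipschitz_ball (X : Type*) [NormedAddCommGroup X] [NormedSpace ℝ X]
    [CompleteSpace X] :
    ∃ δ > 0, ∀ A B : X →L[ℝ] X, ‖A‖ < δ → ‖B‖ < δ →
      ‖NormedSpace.exp A - 1‖ ≤ 2 * ‖A‖ ∧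
      ∀ k, ‖phi k A‖ ≤ 2 ∧ ‖phi k A - phi k B‖ ≤ 2 * ‖A - B‖ := by
  obtain ⟨δ, hδ, h⟩ := exists_exp_lipschitz_ball X
  refine ⟨δ, hδ, fun A B hA hB => ⟨by simpa using (h A 0 hA (by simpa using hδ)).2,
    fun k => ⟨?_, ?_⟩⟩⟩
  · have := intervalIntegral.norm_integral_le_of_norm_le_const (a := (0 : ℝ)) (b := 1) (C := 2)
      (f := fun θ : ℝ =>
        (θ ^ (k - 1) / ((k - 1).factorial : ℝ)) • NormedSpace.exp ((1 - θ) • A)) ?_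
    · simpa [phi] using this
    · intro θ hθ
      rw [uIoc_of_le zero_le_one] at hθ
      rw [norm_smul]
      calc _ ≤ 1 * (2 : ℝ) := mul_le_mul (norm_pow_div_factorial_le_one _ hθ)
            (h _ _ (norm_one_sub_smul_lt hA hθ) (norm_one_sub_smul_lt hA hθ)).1
            (norm_nonneg _) zero_le_one
        _ = 2 := one_mul _
  · rw [phi, phi, ← intervalIntegral.integral_sub
      ((continuous_phi_integrand k A).intervalIntegrable _ _)
      ((continuous_phi_integrand k B).intervalIntegrable _ _)]
    have := intervalIntegral.norm_integral_le_of_norm_le_const (a := (0 : ℝ)) (b := 1)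
      (C := 2 * ‖A - B‖)
      (f := fun θ : ℝ =>
        (θ ^ (k - 1) / ((k - 1).factorial : ℝ)) • NormedSpace.exp ((1 - θ) • A) -
        (θ ^ (k - 1) / ((k - 1).factorial : ℝ)) • NormedSpace.exp ((1 - θ) • B)) ?_
    · simpa using this
    · intro θ hθ
      rw [uIoc_of_le zero_le_one] at hθ
      rw [← smul_sub, norm_smul]
      have h1 := (h _ _ (norm_one_sub_smul_lt hA hθ) (norm_one_sub_smul_lt hB hθ)).2
      rw [← smul_sub, norm_smul, Real.norm_of_nonneg (by linarith [hθ.2] : (0 : ℝ) ≤ 1 - θ)] at h1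
      have h2 : (1 - θ) * ‖A - B‖ ≤ ‖A - B‖ :=
        mul_le_of_le_one_left (norm_nonneg _) (by linarith [hθ.1])
      calc _ ≤ 1 * (2 * ‖A - B‖) := mul_le_mul (norm_pow_div_factorial_le_one _ hθ)
            (h1.trans (by linarith)) (norm_nonneg _) zero_le_one
        _ = _ := one_mul _

/-- Variation of constants: substitute `σ = τ θ` and split the exponential. The integrand no longer
depends on `τ`, so the product rule and the fundamental theorem of calculus give the derivative. The
substitution does not divide by `τ`, hence `τ = 0` is included. -/
theorem pow_smul_phi_eq (k : ℕ) (hk : 1 ≤ k) (J : X →L[ℝ] X) (τ : ℝ) :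
    τ ^ k • phi k (τ • J) = NormedSpace.exp (τ • J) *
      ∫ σ in (0 : ℝ)..τ, (σ ^ (k - 1) / ((k - 1).factorial : ℝ)) •
        NormedSpace.exp ((-σ) • J) := by
  let _ : NormedAlgebra ℚ (X →L[ℝ] X) := NormedAlgebra.restrictScalars ℚ ℝ (X →L[ℝ] X)
  have h1 := intervalIntegral.smul_integral_comp_mul_left (a := (0 : ℝ)) (b := 1)
    (fun σ : ℝ => (σ ^ (k - 1) / ((k - 1).factorial : ℝ)) • NormedSpace.exp ((-σ) • J)) τ
  simp only [mul_zero, mul_one] at h1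
  rw [← h1, mul_smul_comm, ← ContinuousLinearMap.mul_apply' ℝ]
  have hc : Continuous fun θ : ℝ => ((τ * θ) ^ (k - 1) / ((k - 1).factorial : ℝ)) •
      NormedSpace.exp ((-(τ * θ)) • J) :=
    by
    refine Continuous.smul (M := ℝ) ?_ (continuous_exp_smul ?_ J) <;> fun_prop
  rw [← ContinuousLinearMap.intervalIntegral_comp_comm _ (hc.intervalIntegrable _ _), phi,
    ← Nat.sub_add_cancel hk, pow_succ', mul_smul, Nat.add_sub_cancel,
    ← intervalIntegral.integral_smul]
  congr 1
  refine intervalIntegral.integral_congr fun θ _ => ?_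
  have h2 : NormedSpace.exp ((1 - θ) • τ • J) =
      NormedSpace.exp (τ • J) * NormedSpace.exp ((-(τ * θ)) • J) := by
    rw [← NormedSpace.exp_add_of_commute (((Commute.refl J).smul_left _).smul_right _),
      ← add_smul, smul_smul]
    congr 2; ring
  simp only [ContinuousLinearMap.mul_apply', mul_smul_comm]
  rw [h2, smul_smul]
  congr 1; ring

/-- The function `τ ^ k φ_k (τ J)` solves `W' = J W + τ ^ (k - 1) / (k - 1)!`. -/
theorem hasDerivAt_pow_smul_phi (k : ℕ) (hk : 1 ≤ k) (J : X →L[ℝ] X) (τ : ℝ) :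
    HasDerivAt (fun τ : ℝ => τ ^ k • phi k (τ • J))
      (J * (τ ^ k • phi k (τ • J)) + (τ ^ (k - 1) / ((k - 1).factorial : ℝ)) • 1) τ := by
  let _ : NormedAlgebra ℚ (X →L[ℝ] X) := NormedAlgebra.restrictScalars ℚ ℝ (X →L[ℝ] X)
  simp only [pow_smul_phi_eq k hk]
  have hc : Continuous fun σ : ℝ => (σ ^ (k - 1) / ((k - 1).factorial : ℝ)) •
      NormedSpace.exp ((-σ) • J) :=
    by
    refine Continuous.smul (M := ℝ) ?_ (continuous_exp_smul ?_ J) <;> fun_prop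
  have h := (hasDerivAt_exp_smul_const' J τ).mul
    (intervalIntegral.integral_hasDerivAt_right (hc.intervalIntegrable 0 τ)
      (hc.stronglyMeasurableAtFilter _ _) hc.continuousAt)
  refine h.congr_deriv ?_
  rw [mul_smul_comm, ← NormedSpace.exp_add_of_commute
    (((Commute.refl J).smul_left _).smul_right _), ← add_smul, mul_assoc]
  simp

end Phi

/-! ### Uniform regularity of the right-hand side in the strip -/

namespace IVP
variable {X : Type*} [NormedAddCommGroup X] [NormedSpace ℝ X]

/-- Uniform bounds and Lipschitz conditions (in the second variable, with constant `B`) for `F`,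
its Jacobian and its time derivative in the strip of radius `ρ` along `u`. -/
structure IsRegularAlong (P : IVP X) (u : ℝ → X) (ρ B : ℝ) : Prop where
  norm_F : ∀ t x, (t, x) ∈ P.strip u ρ → ‖P.F t x‖ ≤ B
  norm_jac : ∀ t x, (t, x) ∈ P.strip u ρ → ‖P.jac t x‖ ≤ B
  norm_dt : ∀ t x, (t, x) ∈ P.strip u ρ → ‖P.dt t x‖ ≤ B
  lip_F : ∀ t x y, (t, x) ∈ P.strip u ρ → (t, y) ∈ P.strip u ρ →
    ‖P.F t x - P.F t y‖ ≤ B * ‖x - y‖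
  lip_jac : ∀ t x y, (t, x) ∈ P.strip u ρ → (t, y) ∈ P.strip u ρ →
    ‖P.jac t x - P.jac t y‖ ≤ B * ‖x - y‖
  lip_dt : ∀ t x y, (t, x) ∈ P.strip u ρ → (t, y) ∈ P.strip u ρ →
    ‖P.dt t x - P.dt t y‖ ≤ B * ‖x - y‖
  lip_sol : ∀ s ∈ Icc P.t₀ P.T, ∀ t ∈ Icc P.t₀ P.T, ‖u s - u t‖ ≤ B * |s - t|

variable {P : IVP X} {u : ℝ → X} {ρ : ℝ}

omit [NormedSpace ℝ X] in
-- By continuity of `u` the strip is relatively open in `[t₀, T] × X`; so derivatives within the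
-- strip are derivatives within the product, where they are unique.
theorem strip_mem_nhdsWithin (hu : ContinuousOn u (Icc P.t₀ P.T)) {z : ℝ × X}
    (hz : z ∈ P.strip u ρ) : P.strip u ρ ∈ 𝓝[Icc P.t₀ P.T ×ˢ univ] z := by
  have h1 : ContinuousWithinAt (fun w : ℝ × X => ‖w.2 - u w.1‖) (Icc P.t₀ P.T ×ˢ univ) z :=
    (continuous_snd.continuousWithinAt.sub
      ((hu z.1 hz.1).comp continuous_fst.continuousWithinAt fun w hw => hw.1)).norm
  filter_upwards [h1.eventually_lt_const hz.2, self_mem_nhdsWithin] with w hw hw'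
  exact ⟨hw'.1, hw⟩

theorem uniqueDiffOn_strip (hT : P.t₀ < P.T) (hu : ContinuousOn u (Icc P.t₀ P.T)) :
    UniqueDiffOn ℝ (P.strip u ρ) := fun z hz =>
  ((uniqueDiffOn_Icc hT).prod uniqueDiffOn_univ z ⟨hz.1, mem_univ _⟩).mono_nhds
    (nhdsWithin_le_iff.2 (strip_mem_nhdsWithin hu hz))

section
variable {Y : Type*} [NormedAddCommGroup Y] [NormedSpace ℝ Y] {G : ℝ × X → Y}
  {G' : ℝ × X →L[ℝ] Y} {t : ℝ} {x : X}

/-- At fixed time the strip is an open ball, so the spatial derivative is a full one, as `jac`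
requires. -/
theorem hasFDerivAt_slice (h : HasFDerivWithinAt G G' (P.strip u ρ) (t, x))
    (hz : (t, x) ∈ P.strip u ρ) :
    HasFDerivAt (fun y => G (t, y)) (G'.comp (ContinuousLinearMap.inr ℝ ℝ X)) x := by
  have hm : MapsTo (fun y : X => (t, y)) (Metric.ball (u t) ρ) (P.strip u ρ) := fun y hy =>
    ⟨hz.1, by simpa [dist_eq_norm] using hy⟩
  have hb : Metric.ball (u t) ρ ∈ 𝓝 x :=
    Metric.isOpen_ball.mem_nhds (by simpa [dist_eq_norm] using hz.2)
  exact (h.comp x (hasFDerivAt_prodMk_right t x).hasFDerivWithinAt hm).hasFDerivAt hb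

theorem hasDerivWithinAt_slice (hu : ContinuousOn u (Icc P.t₀ P.T))
    (h : HasFDerivWithinAt G G' (P.strip u ρ) (t, x)) (hz : (t, x) ∈ P.strip u ρ) :
    HasDerivWithinAt (fun τ => G (τ, x)) (G' (1, 0)) (Icc P.t₀ P.T) t := by
  have h' := h.mono_of_mem_nhdsWithin (strip_mem_nhdsWithin hu hz)
  have hm : MapsTo (fun τ : ℝ => (τ, x)) (Icc P.t₀ P.T) (Icc P.t₀ P.T ×ˢ univ) := fun τ hτ =>
    ⟨hτ, mem_univ _⟩
  exact h'.comp_hasDerivWithinAt t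
    ((hasDerivAt_id t).prodMk (hasDerivAt_const t x)).hasDerivWithinAt hm

/-- The strip need not be convex, but its slices at fixed time are balls; the mean value inequality
is applied there. -/
theorem norm_sub_le_of_fderivWithin_strip {G' : ℝ × X → ℝ × X →L[ℝ] Y} {B : ℝ}
    (h : ∀ z ∈ P.strip u ρ, HasFDerivWithinAt G (G' z) (P.strip u ρ) z)
    (hB : ∀ z ∈ P.strip u ρ, ‖G' z‖ ≤ B) {x y : X} (hx : (t, x) ∈ P.strip u ρ)
    (hy : (t, y) ∈ P.strip u ρ) : ‖G (t, x) - G (t, y)‖ ≤ B * ‖x - y‖ := by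
  have hmem : ∀ {z}, z ∈ Metric.ball (u t) ρ ↔ (t, z) ∈ P.strip u ρ := fun {z} => by
    simp [strip, dist_eq_norm, hx.1.1, hx.1.2]
  refine (convex_ball (u t) ρ).norm_image_sub_le_of_norm_hasFDerivWithin_le
    (f := fun y => G (t, y)) (f' := fun z => (G' (t, z)).comp (ContinuousLinearMap.inr ℝ ℝ X))
    (fun z hz => (hasFDerivAt_slice (h _ (hmem.1 hz)) (hmem.1 hz)).hasFDerivWithinAt)
    (fun z hz => ?_) (hmem.2 hy) (hmem.2 hx)
  refine (ContinuousLinearMap.opNorm_comp_le _ _).trans ?_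
  exact (mul_le_of_le_one_right (norm_nonneg _)
    (ContinuousLinearMap.norm_inr_le_one ℝ ℝ X)).trans (hB _ (hmem.1 hz))

end

/-- `jac` and `dt` are obtained from the total derivative by contractions, so their Lipschitz bounds
come from the second derivative; this is where `2 ≤ K` enters. The solution is Lipschitz because its
derivative is `F` along itself. -/
theorem IsSmoothAlong.exists_isRegularAlong {K : ℕ} (hs : P.IsSmoothAlong u K) (hK : 2 ≤ K)
    (hT : P.t₀ < P.T) (hu : P.IsSolution u) :
    ∃ ρ B : ℝ, 0 < ρ ∧ ρ ≤ 1 ∧ 0 ≤ B ∧ P.IsRegularAlong u ρ B := by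
  have hc : ContinuousOn u (Icc P.t₀ P.T) := hs.sol.continuousOn
  obtain ⟨ρ, hρ, hF, hb⟩ := hs.rhs
  obtain ⟨M₀, h₀⟩ := hb 0 (by omega)
  obtain ⟨M₁, h₁⟩ := hb 1 (by omega)
  obtain ⟨M₂, h₂⟩ := hb 2 hK
  have hU := uniqueDiffOn_strip (ρ := ρ) hT hc
  set G : ℝ × X → X := fun z => P.F z.1 z.2
  set S := P.strip u ρ
  have hK' : ((2 : ℕ) : WithTop ℕ∞) ≤ K := by exact_mod_cast hK
  have hF2 : ContDiffOn ℝ 2 G S := hF.of_le hK'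
  have hG : ∀ z ∈ S, HasFDerivWithinAt G (fderivWithin ℝ G S z) S z := fun z hz =>
    (hF2.differentiableOn (by norm_num) z hz).hasFDerivWithinAt
  have hDG : ∀ z ∈ S, HasFDerivWithinAt (fderivWithin ℝ G S)
      (fderivWithin ℝ (fderivWithin ℝ G S) S z) S z := fun z hz =>
    ((hF2.fderivWithin hU (m := 1) (by norm_num)).differentiableOn (by norm_num) z
      hz).hasFDerivWithinAt
  set B := max (max M₀ M₁) (max M₂ 0)
  have b₀ : ∀ z ∈ S, ‖G z‖ ≤ B := fun z hz => by
    have := h₀ z hz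
    rw [norm_iteratedFDerivWithin_zero] at this
    exact this.trans ((le_max_left _ _).trans (le_max_left _ _))
  have b₁ : ∀ z ∈ S, ‖fderivWithin ℝ G S z‖ ≤ B := fun z hz => by
    have := h₁ z hz
    rw [← zero_add 1, ← norm_iteratedFDerivWithin_fderivWithin hU hz,
      norm_iteratedFDerivWithin_zero] at this
    exact this.trans ((le_max_right _ _).trans (le_max_left _ _))
  have b₂ : ∀ z ∈ S, ‖fderivWithin ℝ (fderivWithin ℝ G S) S z‖ ≤ B := fun z hz => by
    have := h₂ z hz
    rw [← one_add_one_eq_two, ← norm_iteratedFDerivWithin_fderivWithin hU hz, ← zero_add 1,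
      ← norm_iteratedFDerivWithin_fderivWithin hU hz, norm_iteratedFDerivWithin_zero] at this
    exact this.trans ((le_max_left _ _).trans (le_max_right _ _))
  have hB : 0 ≤ B := (le_max_right _ _).trans (le_max_right _ _)
  have hjac : ∀ t x, (t, x) ∈ S →
      P.jac t x = (fderivWithin ℝ G S (t, x)).comp (ContinuousLinearMap.inr ℝ ℝ X) :=
    fun t x hz => (hasFDerivAt_slice (hG _ hz) hz).fderiv
  have hdt : ∀ t x, (t, x) ∈ S → P.dt t x = fderivWithin ℝ G S (t, x) (1, 0) :=
    fun t x hz => (hasDerivWithinAt_slice hc (hG _ hz) hz).derivWithin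
      (uniqueDiffOn_Icc hT t hz.1)
  have hinr : ∀ A : ℝ × X →L[ℝ] X, ‖A.comp (ContinuousLinearMap.inr ℝ ℝ X)‖ ≤ ‖A‖ := fun A =>
    (ContinuousLinearMap.opNorm_comp_le _ _).trans
      (mul_le_of_le_one_right (norm_nonneg _) (ContinuousLinearMap.norm_inr_le_one ℝ ℝ X))
  have hone : ∀ A : ℝ × X →L[ℝ] X, ‖A (1, 0)‖ ≤ ‖A‖ := fun A => by
    simpa [Prod.norm_def] using A.le_opNorm (1, 0)
  have hsub : P.strip u (min ρ 1) ⊆ S := fun z hz => ⟨hz.1, hz.2.trans_le (min_le_left _ _)⟩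
  refine ⟨min ρ 1, B, by positivity, min_le_right _ _, hB, ?_⟩
  refine ⟨fun t x hz => b₀ _ (hsub hz), fun t x hz => ?_, fun t x hz => ?_,
    fun t x y hx hy => norm_sub_le_of_fderivWithin_strip hG b₁ (hsub hx) (hsub hy),
    fun t x y hx hy => ?_, fun t x y hx hy => ?_, fun s hs t ht => ?_⟩
  · rw [hjac _ _ (hsub hz)]
    exact (hinr _).trans (b₁ _ (hsub hz))
  · rw [hdt _ _ (hsub hz)]
    exact (hone _).trans (b₁ _ (hsub hz))
  · rw [hjac _ _ (hsub hx), hjac _ _ (hsub hy), ← ContinuousLinearMap.sub_comp]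
    exact (hinr _).trans (norm_sub_le_of_fderivWithin_strip hDG b₂ (hsub hx) (hsub hy))
  · rw [hdt _ _ (hsub hx), hdt _ _ (hsub hy), ← sub_apply]
    exact (hone _).trans (norm_sub_le_of_fderivWithin_strip hDG b₂ (hsub hx) (hsub hy))
  · rw [← Real.norm_eq_abs]
    exact (convex_Icc P.t₀ P.T).norm_image_sub_le_of_norm_hasDerivWithin_le hu.ode
      (fun r hr => b₀ (r, u r) ⟨hr, by simpa using hρ⟩) ht hs

end IVP

/-! ### Exact solutions and numerical integration of the fast linear equations -/

section
variable {X : Type*} [NormedAddCommGroup X] [NormedSpace ℝ X]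

/-- The increment over `[0, σ]` of the exact solution of a fast equation. -/
noncomputable def fastIncrement (H σ : ℝ) (J : X →L[ℝ] X) (f V : X) (s : Finset ℕ) (ℓ : ℕ → ℕ)
    (γ : ℕ → ℕ → ℝ) (D : ℕ → X) : X :=
  σ • phi 1 (σ • J) f + σ ^ 2 • phi 2 (σ • J) V
    + H • ∑ j ∈ s, (∑ k ∈ Finset.Icc 1 (ℓ j), γ j k • phi k (σ • J)) (D j)

/-- The exact solution of a fast equation with initial value `v`. -/
noncomputable def fastSolution (H c : ℝ) (J : X →L[ℝ] X) (v f V : X) (s : Finset ℕ) (ℓ : ℕ → ℕ)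
    (γ : ℕ → ℕ → ℝ) (D : ℕ → X) (τ : ℝ) : X :=
  v + ((τ ^ 1 • phi 1 (τ • J)) f + (τ ^ 2 • phi 2 (τ • J)) V
    + ∑ j ∈ s, (∑ k ∈ Finset.Icc 1 (ℓ j),
        (γ j k / (c ^ k * H ^ (k - 1))) • (τ ^ k • phi k (τ • J))) (D j))

variable (J : X →L[ℝ] X) (v f V : X) (s : Finset ℕ) (ℓ : ℕ → ℕ) (γ : ℕ → ℕ → ℝ) (D : ℕ → X)

theorem fastSolution_zero (H c : ℝ) : fastSolution H c J v f V s ℓ γ D 0 = v := by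
  have : ∀ j ∈ s, (∑ k ∈ Finset.Icc 1 (ℓ j),
      (γ j k / (c ^ k * H ^ (k - 1))) • ((0 : ℝ) ^ k • phi k ((0 : ℝ) • J))) (D j) = 0 := by
    intro j _
    rw [Finset.sum_eq_zero, zero_apply]
    intro k hk
    rw [zero_pow (by have := (Finset.mem_Icc.1 hk).1; omega), zero_smul, smul_zero]
  rw [fastSolution, Finset.sum_eq_zero this]
  simp

/-- The scaling of the forcing polynomial is chosen for this: `(c H) ^ k / (c ^ k H ^ (k - 1)) = H`,
so at `τ = c H` the forcing terms become `H` times the weights of the Rosenbrock method. -/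
theorem fastSolution_eq_add_fastIncrement {H c : ℝ} (hH : H ≠ 0) (hc : c ≠ 0) :
    fastSolution H c J v f V s ℓ γ D (c * H) = v + fastIncrement H (c * H) J f V s ℓ γ D := by
  unfold fastSolution fastIncrement
  rw [pow_one, Finset.smul_sum]
  congr 2
  refine Finset.sum_congr rfl fun j _ => ?_
  rw [← smul_apply, Finset.smul_sum]
  congr 1
  refine Finset.sum_congr rfl fun k hk => ?_
  obtain ⟨n, rfl⟩ := Nat.exists_eq_add_of_le' (Finset.mem_Icc.1 hk).1
  rw [smul_smul, smul_smul, Nat.add_sub_cancel]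
  congr 1
  field_simp
  ring

/-- Superposition of the equations for `τ ^ k φ_k (τ J)`; the constant part `v` accounts for `-J v`
in the forcing. -/
theorem hasDerivAt_fastSolution [CompleteSpace X] (H c τ : ℝ) :
    HasDerivAt (fastSolution H c J v f V s ℓ γ D)
      (J (fastSolution H c J v f V s ℓ γ D τ) + (f - J v + τ • V + ∑ j ∈ s,
        (∑ k ∈ Finset.Icc 1 (ℓ j),
          γ j k / (c ^ k * H ^ (k - 1) * ((k - 1).factorial : ℝ)) * τ ^ (k - 1)) • D j)) τ := by
  have hW : ∀ (k : ℕ) (x : X), 1 ≤ k → HasDerivAt (fun τ : ℝ => (τ ^ k • phi k (τ • J)) x)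
      (J ((τ ^ k • phi k (τ • J)) x) + (τ ^ (k - 1) / ((k - 1).factorial : ℝ)) • x) τ :=
    fun k x hk => by
      simpa using (hasDerivAt_pow_smul_phi k hk J τ).clm_apply (hasDerivAt_const τ x)
  have hS : HasDerivAt (fun τ : ℝ => ∑ j ∈ s, (∑ k ∈ Finset.Icc 1 (ℓ j),
        (γ j k / (c ^ k * H ^ (k - 1))) • (τ ^ k • phi k (τ • J))) (D j))
      (∑ j ∈ s, ∑ k ∈ Finset.Icc 1 (ℓ j), (γ j k / (c ^ k * H ^ (k - 1))) •
        (J ((τ ^ k • phi k (τ • J)) (D j)) +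
          (τ ^ (k - 1) / ((k - 1).factorial : ℝ)) • D j)) τ := by
    refine HasDerivAt.fun_sum fun j _ => ?_
    have h : (fun τ : ℝ => (∑ k ∈ Finset.Icc 1 (ℓ j),
        (γ j k / (c ^ k * H ^ (k - 1))) • (τ ^ k • phi k (τ • J))) (D j)) =
        fun τ : ℝ => ∑ k ∈ Finset.Icc 1 (ℓ j), (γ j k / (c ^ k * H ^ (k - 1))) •
          ((τ ^ k • phi k (τ • J)) (D j)) := by
      funext τ; simp only [sum_apply, smul_apply]
    rw [h]
    exact HasDerivAt.fun_sum fun k hk => (hW k (D j) (Finset.mem_Icc.1 hk).1).const_smul _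
  have h := (((hW 1 f le_rfl).add (hW 2 V one_le_two)).add hS).const_add v
  refine h.congr_deriv ?_
  unfold fastSolution
  have e : ∀ j k, γ j k / (c ^ k * H ^ (k - 1) * ((k - 1).factorial : ℝ)) * τ ^ (k - 1) =
      γ j k / (c ^ k * H ^ (k - 1)) * (τ ^ (k - 1) / ((k - 1).factorial : ℝ)) := fun j k => by
    rw [← div_div]; ring
  simp only [map_add, map_sum, sum_apply, smul_apply,
    smul_add, Finset.sum_add_distrib, map_smul, Finset.sum_smul, smul_smul, e]
  simp
  abel

/-- The error of a fast integration of a linear equation. -/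
theorem Micro.IsRun.norm_sub_le [CompleteSpace X] {R : Micro X} {Ψ : Solver X}
    {F : ℝ → X → X} {S h : ℝ} {y₀ : X} (hR : R.IsRun Ψ F S h y₀) {q : ℕ} {K : ℝ}
    (hO : R.HasOrder F q K) {J : X →L[ℝ] X} {g : ℝ → X} (hF : ∀ τ y, F τ y = J y + g τ)
    {z : ℝ → X} (hz₀ : z 0 = y₀) (hz : ∀ τ, HasDerivAt z (J (z τ) + g τ) τ) {b : ℝ} (hb : 0 ≤ b)
    (hJ : ∀ k, 0 ≤ k → k ≤ h → ‖NormedSpace.exp (k • J) - 1‖ ≤ b * k) :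
    ‖R.y R.N - z S‖ ≤ Real.exp (b * S) * S * (|K| * h ^ q) := by
  have key : ∀ j ≤ R.N, 0 ≤ R.τ j ∧
      ‖R.y j - z (R.τ j)‖ ≤ Real.exp (b * R.τ j) * R.τ j * (|K| * h ^ q) := by
    intro j
    induction j with
    | zero => intro _; simp [hR.start, hR.init, hz₀]
    | succ j ih =>
      intro hj
      obtain ⟨h0, he⟩ := ih (by omega)
      have hlt := hR.lt j hj
      have hle := hR.le j hj
      set k := R.τ (j + 1) - R.τ j with hk
      have hk0 : 0 < k := sub_pos.2 hlt
      set w := R.y j - z (R.τ j) with hw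
      -- By linearity this is the exact solution through the computed value: the reference solution
      -- plus the propagated error `w`.
      have hloc := hO j hj (fun σ => z σ + NormedSpace.exp ((σ - R.τ j) • J) w) (by simp [hw])
        (fun σ _ => by
          have h1 : HasDerivAt (fun σ : ℝ => NormedSpace.exp ((σ - R.τ j) • J) w)
              ((J * NormedSpace.exp ((σ - R.τ j) • J)) w) σ := by
            have h2 := (hasDerivAt_exp_smul_const' J (σ - R.τ j)).scomp σ
              ((hasDerivAt_id σ).sub_const (R.τ j))
            simpa [Function.comp_def] using h2.clm_apply (hasDerivAt_const σ w)
          refine (((hz σ).add h1).congr_deriv ?_).hasDerivWithinAt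
          rw [hF, map_add, mul_apply_eq_comp]
          abel)
      -- One factor `k` is kept, since the micro steps sum to `S`; the others are bounded by `h`.
      -- Nothing is assumed about the sign of `K`.
      have hKk : K * k ^ (q + 1) ≤ k * (|K| * h ^ q) := by
        have h1 : k ^ q ≤ h ^ q := pow_le_pow_left₀ hk0.le hle q
        calc K * k ^ (q + 1) ≤ |K| * k ^ (q + 1) := by gcongr; exact le_abs_self K
          _ = k * (|K| * k ^ q) := by ring
          _ ≤ _ := by gcongr
      have hexp : ‖NormedSpace.exp (k • J) w‖ ≤ (1 + b * k) * ‖w‖ := by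
        have h1 := ContinuousLinearMap.le_of_opNorm_le _ (hJ k hk0.le hle) w
        have h2 := norm_add_le ((NormedSpace.exp (k • J) - 1) w) w
        simp only [sub_apply, one_apply_eq_self, sub_add_cancel] at h1 h2
        linarith
      have h1 : 1 + b * k ≤ Real.exp (b * k) := by
        have := Real.add_one_le_exp (b * k); linarith
      have hA : 0 ≤ |K| * h ^ q := by
        have : 0 ≤ h := hk0.le.trans hle
        positivity
      have hτ : R.τ (j + 1) = R.τ j + k := by rw [hk]; ring
      refine ⟨h0.trans hlt.le, ?_⟩
      calc ‖R.y (j + 1) - z (R.τ (j + 1))‖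
          = ‖(R.y (j + 1) - (z (R.τ (j + 1)) + NormedSpace.exp (k • J) w))
              + NormedSpace.exp (k • J) w‖ := by congr 1; abel
        _ ≤ k * (|K| * h ^ q) + (1 + b * k) * ‖w‖ :=
            (norm_add_le _ _).trans (add_le_add (hloc.trans hKk) hexp)
        _ ≤ Real.exp (b * R.τ (j + 1)) * (k * (|K| * h ^ q)) +
            Real.exp (b * k) * (Real.exp (b * R.τ j) * R.τ j * (|K| * h ^ q)) := by
            refine add_le_add (le_mul_of_one_le_left (by positivity) ?_) ?_
            · exact Real.one_le_exp (mul_nonneg hb (h0.trans hlt.le))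
            · gcongr
        _ = _ := by
            rw [hτ, mul_add, Real.exp_add]; ring
  have := (key R.N le_rfl).2
  rwa [hR.stop_at] at this

variable {J v f V s ℓ γ D}

/-- Bound for a combination of bounded operators whose coefficients have absolute sum at most `Γ`. -/
theorem norm_sum_phi_apply_le {A Γ d : ℝ} (hd : 0 ≤ d) (hA : 0 ≤ A)
    (W : ℕ → X →L[ℝ] X) (hW : ∀ k, ‖W k‖ ≤ A) (hD : ∀ j ∈ s, ‖D j‖ ≤ d)
    (hΓ : ∑ j ∈ s, ∑ k ∈ Finset.Icc 1 (ℓ j), |γ j k| ≤ Γ) :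
    ‖∑ j ∈ s, (∑ k ∈ Finset.Icc 1 (ℓ j), γ j k • W k) (D j)‖ ≤ Γ * (A * d) := by
  calc _ ≤ ∑ j ∈ s, (∑ k ∈ Finset.Icc 1 (ℓ j), |γ j k|) * (A * d) := by
        refine norm_sum_le_of_le _ fun j hj => ?_
        rw [sum_apply, Finset.sum_mul]
        refine norm_sum_le_of_le _ fun k _ => ?_
        rw [smul_apply, norm_smul, Real.norm_eq_abs]
        gcongr
        exact ContinuousLinearMap.le_of_opNorm_le_of_le _ (hW k) (hD j hj)
    _ = (∑ j ∈ s, ∑ k ∈ Finset.Icc 1 (ℓ j), |γ j k|) * (A * d) := by rw [Finset.sum_mul]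
    _ ≤ _ := by gcongr

theorem norm_fastIncrement_le {H σ B d Γ : ℝ} (hσ : 0 ≤ σ) (hσH : σ ≤ H) (hH : H ≤ 1)
    (hd : 0 ≤ d) (hφ : ∀ k, ‖phi k (σ • J)‖ ≤ 2) (hf : ‖f‖ ≤ B) (hV : ‖V‖ ≤ B)
    (hD : ∀ j ∈ s, ‖D j‖ ≤ d) (hΓ : ∑ j ∈ s, ∑ k ∈ Finset.Icc 1 (ℓ j), |γ j k| ≤ Γ) :
    ‖fastIncrement H σ J f V s ℓ γ D‖ ≤ H * (4 * B + 2 * Γ * d) := by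
  have hB : 0 ≤ B := (norm_nonneg f).trans hf
  have hH0 : 0 ≤ H := hσ.trans hσH
  have h1 : ‖σ • phi 1 (σ • J) f‖ ≤ H * (2 * B) := by
    rw [norm_smul, Real.norm_of_nonneg hσ]
    gcongr
    exact ContinuousLinearMap.le_of_opNorm_le_of_le _ (hφ 1) hf
  have h2 : ‖σ ^ 2 • phi 2 (σ • J) V‖ ≤ H * (2 * B) := by
    rw [norm_smul, Real.norm_of_nonneg (by positivity)]
    have : σ ^ 2 ≤ H := by nlinarith
    gcongr
    exact ContinuousLinearMap.le_of_opNorm_le_of_le _ (hφ 2) hV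
  have h3 : ‖H • ∑ j ∈ s, (∑ k ∈ Finset.Icc 1 (ℓ j), γ j k • phi k (σ • J)) (D j)‖ ≤
      H * (Γ * (2 * d)) := by
    rw [norm_smul, Real.norm_of_nonneg hH0]
    gcongr
    exact norm_sum_phi_apply_le hd zero_le_two _ hφ hD hΓ
  refine (norm_add₃_le.trans (add_le_add_three h1 h2 h3)).trans (le_of_eq (by ring))

theorem norm_clm_apply_sub_le {A A' : X →L[ℝ] X} {x x' : X} {a b a' b' : ℝ} (ha : ‖A - A'‖ ≤ a)
    (hx : ‖x‖ ≤ b) (hA : ‖A'‖ ≤ a') (hx' : ‖x - x'‖ ≤ b') :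
    ‖A x - A' x'‖ ≤ a * b + a' * b' := by
  have h : A x - A' x' = (A - A') x + A' (x - x') := by simp
  rw [h]
  exact (norm_add_le _ _).trans (add_le_add (ContinuousLinearMap.le_of_opNorm_le_of_le _ ha hx)
    (ContinuousLinearMap.le_of_opNorm_le_of_le _ hA hx'))

/-- Each term is an operator applied to a vector, so operator and vector are varied separately. The
factor `H` in front is what makes a step a `1 + O(H)` perturbation of the identity. -/
theorem norm_fastIncrement_sub_le {H σ B d Γ e e' : ℝ} {J' : X →L[ℝ] X} {f' V' : X} {D' : ℕ → X}
    (hσ : 0 ≤ σ) (hσH : σ ≤ H) (hH : H ≤ 1) (hd : 0 ≤ d) (he : 0 ≤ e) (he' : 0 ≤ e')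
    (hφ : ∀ k, ‖phi k (σ • J')‖ ≤ 2)
    (hφ' : ∀ k, ‖phi k (σ • J) - phi k (σ • J')‖ ≤ 2 * ‖σ • J - σ • J'‖)
    (hf : ‖f‖ ≤ B) (hV : ‖V‖ ≤ B) (hD : ∀ j ∈ s, ‖D j‖ ≤ d)
    (hJJ : ‖J - J'‖ ≤ e) (hff : ‖f - f'‖ ≤ e) (hVV : ‖V - V'‖ ≤ e)
    (hDD : ∀ j ∈ s, ‖D j - D' j‖ ≤ e')
    (hΓ : ∑ j ∈ s, ∑ k ∈ Finset.Icc 1 (ℓ j), |γ j k| ≤ Γ) :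
    ‖fastIncrement H σ J f V s ℓ γ D - fastIncrement H σ J' f' V' s ℓ γ D'‖ ≤
      H * (4 * B * e + 4 * e + 2 * Γ * (d * e + e')) := by
  have hB : 0 ≤ B := (norm_nonneg f).trans hf
  have hH0 : 0 ≤ H := hσ.trans hσH
  have hφe : ∀ k, ‖phi k (σ • J) - phi k (σ • J')‖ ≤ 2 * e := fun k => by
    refine (hφ' k).trans ?_
    rw [← smul_sub, norm_smul, Real.norm_of_nonneg hσ]
    have : σ * ‖J - J'‖ ≤ 1 * e := by gcongr; exact hσH.trans hH
    linarith
  have h1 : ‖σ • phi 1 (σ • J) f - σ • phi 1 (σ • J') f'‖ ≤ H * (2 * e * B + 2 * e) := by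
    rw [← smul_sub, norm_smul, Real.norm_of_nonneg hσ]
    gcongr
    exact norm_clm_apply_sub_le (hφe 1) hf (hφ 1) hff
  have h2 : ‖σ ^ 2 • phi 2 (σ • J) V - σ ^ 2 • phi 2 (σ • J') V'‖ ≤ H * (2 * e * B + 2 * e) := by
    rw [← smul_sub, norm_smul, Real.norm_of_nonneg (by positivity)]
    have : σ ^ 2 ≤ H := by nlinarith
    gcongr
    exact norm_clm_apply_sub_le (hφe 2) hV (hφ 2) hVV
  have h3 : ‖H • ∑ j ∈ s, (∑ k ∈ Finset.Icc 1 (ℓ j), γ j k • phi k (σ • J)) (D j) -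
      H • ∑ j ∈ s, (∑ k ∈ Finset.Icc 1 (ℓ j), γ j k • phi k (σ • J')) (D' j)‖ ≤
      H * (Γ * (2 * e * d) + Γ * (2 * e')) := by
    rw [← smul_sub, norm_smul, Real.norm_of_nonneg hH0]
    gcongr
    have h : ∑ j ∈ s, (∑ k ∈ Finset.Icc 1 (ℓ j), γ j k • phi k (σ • J)) (D j) -
        ∑ j ∈ s, (∑ k ∈ Finset.Icc 1 (ℓ j), γ j k • phi k (σ • J')) (D' j) =
        ∑ j ∈ s, (∑ k ∈ Finset.Icc 1 (ℓ j), γ j k • (phi k (σ • J) - phi k (σ • J'))) (D j) +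
        ∑ j ∈ s, (∑ k ∈ Finset.Icc 1 (ℓ j), γ j k • phi k (σ • J')) (D j - D' j) := by
      rw [← Finset.sum_sub_distrib, ← Finset.sum_add_distrib]
      refine Finset.sum_congr rfl fun j _ => ?_
      simp only [smul_sub, Finset.sum_sub_distrib, sub_apply, map_sub]
      abel
    rw [h]
    exact (norm_add_le _ _).trans (add_le_add
      (norm_sum_phi_apply_le hd (by positivity) _ hφe hD hΓ)
      (norm_sum_phi_apply_le (D := fun j => D j - D' j) he' zero_le_two _ hφ hDD hΓ))
  unfold fastIncrement
  rw [add_sub_add_comm, add_sub_add_comm]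
  exact (norm_add₃_le.trans (add_le_add_three h1 h2 h3)).trans (le_of_eq (by ring))

end

/-! ### Stability of one exponential Rosenbrock step -/

namespace ExpRB
variable {X : Type*} [NormedAddCommGroup X] [NormedSpace ℝ X] (M : ExpRB) (P : IVP X)

/-- The right-hand side of the equation that defines the `i`-th stage. -/
noncomputable def stageMap (H t : ℝ) (v : X) (U : ℕ → X) (i : ℕ) : X :=
  v + fastIncrement H (M.c i * H) (P.jac t v) (P.F t v) (P.dt t v) (Finset.Ico 2 i) (M.ℓ i)
    (M.α i) fun j => M.diff P H t v j (U j)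

/-- The update as a function of the stages. -/
noncomputable def updateMap (H t : ℝ) (v : X) (U : ℕ → X) : X :=
  v + fastIncrement H H (P.jac t v) (P.F t v) (P.dt t v) (Finset.Icc 2 M.s) M.μ M.β
    fun j => M.diff P H t v j (U j)

/-- In this form the exact stages solve an equation that the multirate stages solve up to a defect,
so the two can be compared. -/
theorem stage_eq_stageMap (H t : ℝ) (v : X) (i : ℕ) :
    M.stage P H t v i = M.stageMap P H t v (M.stage P H t v) i := by
  rw [stage, Finset.sum_attach (Finset.Ico 2 i) fun j =>
    M.a i j (H • P.jac t v) (M.diff P H t v j (M.stage P H t v j))]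
  simp only [stageMap, fastIncrement, a, smul_smul, mul_pow, add_assoc]

theorem step_eq_updateMap (H t : ℝ) (v : X) :
    M.step P H t v = M.updateMap P H t v (M.stage P H t v) := by
  simp only [step, updateMap, fastIncrement, b, add_assoc]

/-- The sum of the absolute values of all coefficients. -/
noncomputable def coeffSum : ℝ :=
  ∑ i ∈ Finset.Icc 2 M.s, ∑ j ∈ Finset.Icc 2 M.s, ∑ k ∈ Finset.Icc 1 (M.ℓ i j), |M.α i j k| +
    ∑ i ∈ Finset.Icc 2 M.s, ∑ k ∈ Finset.Icc 1 (M.μ i), |M.β i k|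

theorem coeffSum_nonneg : 0 ≤ M.coeffSum := by unfold coeffSum; positivity

theorem Ico_subset {i : ℕ} (hi : i ∈ Finset.Icc 2 M.s) :
    Finset.Ico 2 i ⊆ Finset.Icc 2 M.s := fun j hj => by
  simp only [Finset.mem_Ico, Finset.mem_Icc] at *
  omega

theorem sum_abs_α_le {i : ℕ} (hi : i ∈ Finset.Icc 2 M.s) :
    ∑ j ∈ Finset.Ico 2 i, ∑ k ∈ Finset.Icc 1 (M.ℓ i j), |M.α i j k| ≤ M.coeffSum := by
  have h1 := Finset.sum_le_sum_of_subset_of_nonneg (M.Ico_subset hi)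
    (f := fun j => ∑ k ∈ Finset.Icc 1 (M.ℓ i j), |M.α i j k|) fun _ _ _ => by positivity
  have h2 := Finset.single_le_sum (s := Finset.Icc 2 M.s)
    (f := fun i => ∑ j ∈ Finset.Icc 2 M.s, ∑ k ∈ Finset.Icc 1 (M.ℓ i j), |M.α i j k|)
    (fun _ _ => by positivity) hi
  have h3 : 0 ≤ ∑ i ∈ Finset.Icc 2 M.s, ∑ k ∈ Finset.Icc 1 (M.μ i), |M.β i k| := by positivity
  unfold coeffSum
  linarith

theorem sum_abs_β_le :
    ∑ i ∈ Finset.Icc 2 M.s, ∑ k ∈ Finset.Icc 1 (M.μ i), |M.β i k| ≤ M.coeffSum := by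
  unfold coeffSum
  exact le_add_of_nonneg_left (by positivity)

/-- A Lipschitz constant of the increments, divided by the step size. -/
noncomputable def lipConst (B : ℝ) : ℝ :=
  4 * B * B + 4 * B + 2 * M.coeffSum * (B * (5 + B) * B + B * (5 + B))

theorem lipConst_nonneg {B : ℝ} (hB : 0 ≤ B) : 0 ≤ M.lipConst B := by
  have := M.coeffSum_nonneg
  unfold lipConst
  positivity

/-- The step size `H` is small with respect to the radius `ρ` of the strip and the bound `B`. -/
structure IsSmallStep (X : Type*) [NormedAddCommGroup X] [NormedSpace ℝ X] (M : ExpRB)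
    (ρ B H : ℝ) : Prop where
  pos : 0 < H
  le_one : H ≤ 1
  norm_exp : ∀ A : X →L[ℝ] X, ‖A‖ ≤ B → ∀ σ, 0 ≤ σ → σ ≤ H →
    ‖NormedSpace.exp (σ • A) - 1‖ ≤ 2 * B * σ
  norm_phi : ∀ A : X →L[ℝ] X, ‖A‖ ≤ B → ∀ σ, 0 ≤ σ → σ ≤ H → ∀ k, ‖phi k (σ • A)‖ ≤ 2
  lip_phi : ∀ A A' : X →L[ℝ] X, ‖A‖ ≤ B → ‖A'‖ ≤ B → ∀ σ, 0 ≤ σ → σ ≤ H → ∀ k,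
    ‖phi k (σ • A) - phi k (σ • A')‖ ≤ 2 * ‖σ • A - σ • A'‖
  near : H * (5 * B + 2 * M.coeffSum * (B * (5 + B))) < ρ / 4
  lip : 3 * (H * M.lipConst B) ≤ 1

theorem exists_forall_mul_lt (a : ℝ) {b : ℝ} (hb : 0 < b) :
    ∃ H₀ > 0, ∀ H : ℝ, 0 < H → H ≤ H₀ → H * a < b := by
  refine ⟨b / (|a| + 1), by positivity, fun H hH hle => ?_⟩
  calc H * a ≤ H * |a| := by gcongr; exact le_abs_self a
    _ < H * (|a| + 1) := by gcongr; linarith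
    _ ≤ b := (le_div_iff₀ (by positivity)).1 hle

/-- `H B < δ` puts every `σ • A` into the ball where `exp` and all `φ_k` are controlled; `near` and
`lip` are linear in `H`. -/
theorem exists_isSmallStep (X : Type*) [NormedAddCommGroup X] [NormedSpace ℝ X] [CompleteSpace X]
    (M : ExpRB) {ρ : ℝ} (B : ℝ) (hρ : 0 < ρ) :
    ∃ H₀ > 0, ∀ H : ℝ, 0 < H → H ≤ H₀ → M.IsSmallStep X ρ B H := by
  obtain ⟨δ, hδ, hφ⟩ := exists_phi_lipschitz_ball X
  obtain ⟨H₁, h₁, h₁'⟩ := exists_forall_mul_lt B hδ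
  obtain ⟨H₂, h₂, h₂'⟩ := exists_forall_mul_lt (5 * B + 2 * M.coeffSum * (B * (5 + B)))
    (show 0 < ρ / 4 by positivity)
  obtain ⟨H₃, h₃, h₃'⟩ := exists_forall_mul_lt (M.lipConst B) (show (0 : ℝ) < 1 / 3 by norm_num)
  refine ⟨min (min H₁ H₂) (min H₃ 1), by positivity, fun H hH hle => ?_⟩
  simp only [le_min_iff] at hle
  obtain ⟨⟨l₁, l₂⟩, l₃, l₄⟩ := hle
  have hs : ∀ A : X →L[ℝ] X, ‖A‖ ≤ B → ∀ σ, 0 ≤ σ → σ ≤ H → ‖σ • A‖ < δ := fun A hA σ h0 hσ => by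
    rw [norm_smul, Real.norm_of_nonneg h0]
    exact (mul_le_mul hσ hA (norm_nonneg _) hH.le).trans_lt (h₁' H hH l₁)
  refine ⟨hH, l₄, fun A hA σ h0 hσ => ?_,
    fun A hA σ h0 hσ k => ((hφ _ _ (hs A hA σ h0 hσ) (hs A hA σ h0 hσ)).2 k).1,
    fun A A' hA hA' σ h0 hσ k => ((hφ _ _ (hs A hA σ h0 hσ) (hs A' hA' σ h0 hσ)).2 k).2,
    h₂' H hH l₂, by linarith [h₃' H hH l₃]⟩
  refine (hφ _ _ (hs A hA σ h0 hσ) (hs A hA σ h0 hσ)).1.trans ?_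
  rw [norm_smul, Real.norm_of_nonneg h0]
  have : σ * ‖A‖ ≤ σ * B := by gcongr
  linarith

variable {M P} {u : ℝ → X} {ρ B H t : ℝ} {v w : X}

omit [NormedAddCommGroup X] [NormedSpace ℝ X] in
theorem node_mem {i : ℕ} (hi : i ∈ Finset.Icc 2 M.s) (hH : 0 < H) (ht : t ∈ Icc P.t₀ P.T)
    (htH : t + H ∈ Icc P.t₀ P.T) :
    0 < M.c i * H ∧ M.c i * H ≤ H ∧ t + M.c i * H ∈ Icc P.t₀ P.T := by
  have h1 := mul_pos (M.c_pos i hi) hH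
  have h2 := mul_le_of_le_one_left hH.le (M.c_le_one i hi)
  exact ⟨h1, h2, by linarith [ht.1], by linarith [htH.2]⟩

/-- Here the Jacobian acts on `x - v` only and the absolute time has cancelled, so every term is
bounded in the strip. -/
theorem diff_eq (H t : ℝ) (v : X) (j : ℕ) (x : X) : M.diff P H t v j x =
    P.F (t + M.c j * H) x - P.F t v - P.jac t v (x - v) - (M.c j * H) • P.dt t v := by
  simp only [diff, IVP.rem, map_sub, add_smul]
  abel

section
variable (hR : P.IsRegularAlong u ρ B) (hρ : ρ ≤ 1) (hB : 0 ≤ B) (hH : 0 < H) (hH1 : H ≤ 1)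
  (ht : t ∈ Icc P.t₀ P.T) (htH : t + H ∈ Icc P.t₀ P.T)
include hR hρ hB hH hH1 ht htH

theorem norm_sub_le_of_mem_strip {j : ℕ} (hj : j ∈ Finset.Icc 2 M.s) {x : X}
    (hv : (t, v) ∈ P.strip u ρ) (hx : (t + M.c j * H, x) ∈ P.strip u ρ) : ‖x - v‖ ≤ 2 + B := by
  obtain ⟨h1, h2, h3⟩ := M.node_mem hj hH ht htH
  have h4 := hR.lip_sol _ h3 _ ht
  rw [add_sub_cancel_left, abs_of_pos h1] at h4
  have h5 : B * (M.c j * H) ≤ B := mul_le_of_le_one_right hB (h2.trans hH1)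
  have h6 := hv.2
  have h7 := hx.2
  simp only at h6 h7
  have h8 : x - v = (x - u (t + M.c j * H)) + (u (t + M.c j * H) - u t) - (v - u t) := by abel
  rw [h8]
  have := norm_sub_le ((x - u (t + M.c j * H)) + (u (t + M.c j * H) - u t)) (v - u t)
  have := norm_add_le (x - u (t + M.c j * H)) (u (t + M.c j * H) - u t)
  linarith

theorem norm_diff_le {j : ℕ} (hj : j ∈ Finset.Icc 2 M.s) {x : X} (hv : (t, v) ∈ P.strip u ρ)
    (hx : (t + M.c j * H, x) ∈ P.strip u ρ) : ‖M.diff P H t v j x‖ ≤ B * (5 + B) := by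
  obtain ⟨h1, h2, -⟩ := M.node_mem hj hH ht htH
  have h3 := ContinuousLinearMap.le_of_opNorm_le_of_le _ (hR.norm_jac _ _ hv)
    (norm_sub_le_of_mem_strip hR hρ hB hH hH1 ht htH hj hv hx)
  have h4 : ‖(M.c j * H) • P.dt t v‖ ≤ 1 * B := by
    rw [norm_smul, Real.norm_of_nonneg h1.le]
    exact mul_le_mul (h2.trans hH1) (hR.norm_dt _ _ hv) (norm_nonneg _) zero_le_one
  rw [diff_eq]
  have h5 := norm_sub_le (P.F (t + M.c j * H) x - P.F t v - P.jac t v (x - v))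
    ((M.c j * H) • P.dt t v)
  have h6 := norm_sub_le (P.F (t + M.c j * H) x - P.F t v) (P.jac t v (x - v))
  have h7 := norm_sub_le (P.F (t + M.c j * H) x) (P.F t v)
  have h8 := hR.norm_F _ _ hx
  have h9 := hR.norm_F _ _ hv
  linarith

/-- The exact count is `B (5 + B)` for `‖v - w‖` and `2 B` for `‖x - y‖`; the larger constant serves
for both. -/
theorem norm_diff_sub_le {j : ℕ} (hj : j ∈ Finset.Icc 2 M.s) {x y : X}
    (hv : (t, v) ∈ P.strip u ρ) (hx : (t + M.c j * H, x) ∈ P.strip u ρ)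
    (hw : (t, w) ∈ P.strip u ρ) (hy : (t + M.c j * H, y) ∈ P.strip u ρ) :
    ‖M.diff P H t v j x - M.diff P H t w j y‖ ≤ B * (5 + B) * (‖v - w‖ + ‖x - y‖) := by
  obtain ⟨h1, h2, -⟩ := M.node_mem hj hH ht htH
  have e1 : (x - v) - (y - w) = (x - y) - (v - w) := by abel
  have h3 := norm_clm_apply_sub_le (hR.lip_jac _ _ _ hv hw)
    (norm_sub_le_of_mem_strip hR hρ hB hH hH1 ht htH hj hv hx) (hR.norm_jac _ _ hw)
    ((congrArg norm e1).le.trans (norm_sub_le (x - y) (v - w)))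
  have h4 : ‖(M.c j * H) • P.dt t v - (M.c j * H) • P.dt t w‖ ≤ 1 * (B * ‖v - w‖) := by
    rw [← smul_sub, norm_smul, Real.norm_of_nonneg h1.le]
    exact mul_le_mul (h2.trans hH1) (hR.lip_dt _ _ _ hv hw) (norm_nonneg _) zero_le_one
  have h5 := hR.lip_F _ _ _ hx hy
  have h6 := hR.lip_F _ _ _ hv hw
  rw [diff_eq, diff_eq]
  set J₁ := P.jac t v (x - v)
  set J₂ := P.jac t w (y - w)
  have e2 : P.F (t + M.c j * H) x - P.F t v - J₁ - (M.c j * H) • P.dt t v -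
      (P.F (t + M.c j * H) y - P.F t w - J₂ - (M.c j * H) • P.dt t w) =
      (P.F (t + M.c j * H) x - P.F (t + M.c j * H) y) - (P.F t v - P.F t w) - (J₁ - J₂) -
      ((M.c j * H) • P.dt t v - (M.c j * H) • P.dt t w) := by abel
  rw [e2]
  have n1 := norm_sub_le ((P.F (t + M.c j * H) x - P.F (t + M.c j * H) y) -
    (P.F t v - P.F t w) - (J₁ - J₂)) ((M.c j * H) • P.dt t v - (M.c j * H) • P.dt t w)
  have n2 := norm_sub_le ((P.F (t + M.c j * H) x - P.F (t + M.c j * H) y) -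
    (P.F t v - P.F t w)) (J₁ - J₂)
  have n3 := norm_sub_le (P.F (t + M.c j * H) x - P.F (t + M.c j * H) y) (P.F t v - P.F t w)
  have p1 : 0 ≤ B * ‖x - y‖ := by positivity
  have p2 : 0 ≤ B * B * ‖x - y‖ := by positivity
  linarith

end

section
variable (hR : P.IsRegularAlong u ρ B) (hρ : ρ ≤ 1) (hB : 0 ≤ B) (hS : M.IsSmallStep X ρ B H)
  (ht : t ∈ Icc P.t₀ P.T) (htH : t + H ∈ Icc P.t₀ P.T)
include hR hρ hB hS ht htH

/-- Stages that satisfy the stage equations up to small defects remain in the strip. -/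
theorem stages_mem_strip (hv : ‖v - u t‖ < ρ / 2) {U : ℕ → X}
    (hU : ∀ i ∈ Finset.Icc 2 M.s, ‖U i - M.stageMap P H t v U i‖ ≤ ρ / 4) :
    ∀ i ∈ Finset.Icc 2 M.s, (t + M.c i * H, U i) ∈ P.strip u ρ := by
  have hv' : (t, v) ∈ P.strip u ρ := ⟨ht, by
    have := (norm_nonneg _).trans_lt hv
    simp only
    linarith⟩
  intro i
  induction i using Nat.strong_induction_on with
  | _ i ih =>
    intro hi
    obtain ⟨h1, h2, h3⟩ := M.node_mem hi hS.pos ht htH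
    refine ⟨h3, ?_⟩
    have hinc := norm_fastIncrement_le (H := H) h1.le h2 hS.le_one
      (show 0 ≤ B * (5 + B) by positivity)
      (hS.norm_phi _ (hR.norm_jac _ _ hv') _ h1.le h2) (hR.norm_F _ _ hv') (hR.norm_dt _ _ hv')
      (D := fun j => M.diff P H t v j (U j))
      (fun j hj => norm_diff_le hR hρ hB hS.pos hS.le_one ht htH (M.Ico_subset hi hj) hv'
        (ih j (Finset.mem_Ico.1 hj).2 (M.Ico_subset hi hj))) (M.sum_abs_α_le hi)
    have hdef := hU i hi
    unfold stageMap at hdef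
    set I := fastIncrement H (M.c i * H) (P.jac t v) (P.F t v) (P.dt t v) (Finset.Ico 2 i)
      (M.ℓ i) (M.α i) fun j => M.diff P H t v j (U j)
    have hlip := hR.lip_sol _ ht _ h3
    rw [sub_add_cancel_left, abs_neg, abs_of_pos h1] at hlip
    have h5 : B * (M.c i * H) ≤ B * H := by gcongr
    -- The radius is spent as follows: `ρ / 4` on the defect, `ρ / 2` on the initial value, and by
    -- `near` less than `ρ / 4` on the increment and the drift of `u` together.
    have e : U i - u (t + M.c i * H) =
        (U i - (v + I)) + (v - u t) + I + (u t - u (t + M.c i * H)) := by abel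
    have n1 := norm_add_le ((U i - (v + I)) + (v - u t) + I) (u t - u (t + M.c i * H))
    have n2 := norm_add₃_le (a := U i - (v + I)) (b := v - u t) (c := I)
    have := hS.near
    simp only
    rw [e]
    linarith

theorem norm_increment_sub_le (hv : (t, v) ∈ P.strip u ρ) (hw : (t, w) ∈ P.strip u ρ)
    {s : Finset ℕ} (hs : s ⊆ Finset.Icc 2 M.s) {U U' : ℕ → X}
    (hU : ∀ i ∈ s, (t + M.c i * H, U i) ∈ P.strip u ρ)
    (hU' : ∀ i ∈ s, (t + M.c i * H, U' i) ∈ P.strip u ρ) {d : ℝ} (hd0 : 0 ≤ d)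
    (hd : ∀ i ∈ s, ‖U i - U' i‖ ≤ d) {σ : ℝ} (hσ : 0 ≤ σ) (hσH : σ ≤ H) {ℓ : ℕ → ℕ}
    {γ : ℕ → ℕ → ℝ} (hΓ : ∑ j ∈ s, ∑ k ∈ Finset.Icc 1 (ℓ j), |γ j k| ≤ M.coeffSum) :
    ‖fastIncrement H σ (P.jac t v) (P.F t v) (P.dt t v) s ℓ γ
        (fun j => M.diff P H t v j (U j)) -
      fastIncrement H σ (P.jac t w) (P.F t w) (P.dt t w) s ℓ γ
        (fun j => M.diff P H t w j (U' j))‖ ≤ H * M.lipConst B * (‖v - w‖ + d) := by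
  have h := norm_fastIncrement_sub_le (H := H) (σ := σ) (B := B) (d := B * (5 + B))
    (e := B * ‖v - w‖) (e' := B * (5 + B) * (‖v - w‖ + d)) hσ hσH hS.le_one (by positivity)
    (by positivity) (by positivity)
    (hS.norm_phi _ (hR.norm_jac _ _ hw) _ hσ hσH)
    (hS.lip_phi _ _ (hR.norm_jac _ _ hv) (hR.norm_jac _ _ hw) _ hσ hσH)
    (hR.norm_F _ _ hv) (hR.norm_dt _ _ hv) (D := fun j => M.diff P H t v j (U j))
    (fun j hj => norm_diff_le hR hρ hB hS.pos hS.le_one ht htH (hs hj) hv (hU j hj))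
    (hR.lip_jac _ _ _ hv hw) (hR.lip_F _ _ _ hv hw) (hR.lip_dt _ _ _ hv hw)
    (D' := fun j => M.diff P H t w j (U' j))
    (fun j hj => (norm_diff_sub_le hR hρ hB hS.pos hS.le_one ht htH (hs hj) hv (hU j hj) hw
      (hU' j hj)).trans (by gcongr; exact hd j hj)) hΓ
  refine h.trans ?_
  rw [mul_assoc H]
  refine mul_le_mul_of_nonneg_left ?_ hS.pos.le
  have p1 : 0 ≤ (4 * B * B + 4 * B) * d := by positivity
  have p2 : 0 ≤ 2 * M.coeffSum * (B * (5 + B) * B * d) := by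
    have := M.coeffSum_nonneg
    positivity
  unfold lipConst
  linarith

/-- Stability of one step with respect to the initial value and to defects of the stages. -/
theorem norm_updateMap_sub_le (hv : ‖v - u t‖ < ρ / 2) (hw : ‖w - u t‖ < ρ / 2) {U : ℕ → X}
    {ε : ℝ} (hε : 0 ≤ ε) (hερ : ε ≤ ρ / 4)
    (hU : ∀ i ∈ Finset.Icc 2 M.s, ‖U i - M.stageMap P H t v U i‖ ≤ ε) :
    ‖M.updateMap P H t v U - M.step P H t w‖ ≤
      ‖v - w‖ + 3 * (H * M.lipConst B) * (‖v - w‖ + ε) := by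
  set U' := M.stage P H t w with hU'def
  have hρ0 : 0 < ρ := by linarith [(norm_nonneg _).trans_lt hv]
  have mU := stages_mem_strip hR hρ hB hS ht htH hv fun i hi => (hU i hi).trans hερ
  have mU' := stages_mem_strip hR hρ hB hS ht htH hw (U := U') fun i _ => by
    rw [hU'def, ← stage_eq_stageMap, sub_self, norm_zero]; linarith
  have hv' : (t, v) ∈ P.strip u ρ := ⟨ht, show ‖v - u t‖ < ρ by linarith⟩
  have hw' : (t, w) ∈ P.strip u ρ := ⟨ht, show ‖w - u t‖ < ρ by linarith⟩
  have hd0 : 0 ≤ 2 * (‖v - w‖ + ε) := by positivity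
  have hL : 0 ≤ H * M.lipConst B := mul_nonneg hS.pos.le (M.lipConst_nonneg hB)
  have hsmall : H * M.lipConst B * (‖v - w‖ + 2 * (‖v - w‖ + ε)) ≤
      3 * (H * M.lipConst B) * (‖v - w‖ + ε) := by
    have := mul_nonneg hL hε
    linarith
  -- The constant `2` reproduces itself: defect and initial difference use it once, and the earlier
  -- stages add at most as much again because `3 H L ≤ 1` with `L` the Lipschitz constant. Hence it
  -- does not grow with the number of stages.
  have hdiff : ∀ i ∈ Finset.Icc 2 M.s, ‖U i - U' i‖ ≤ 2 * (‖v - w‖ + ε) := by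
    intro i
    induction i using Nat.strong_induction_on with
    | _ i ih =>
      intro hi
      obtain ⟨h1, h2, -⟩ := M.node_mem hi hS.pos ht htH
      have hinc := norm_increment_sub_le hR hρ hB hS ht htH hv' hw' (M.Ico_subset hi)
        (fun j hj => mU j (M.Ico_subset hi hj)) (fun j hj => mU' j (M.Ico_subset hi hj)) hd0
        (fun j hj => ih j (Finset.mem_Ico.1 hj).2 (M.Ico_subset hi hj)) h1.le h2
        (M.sum_abs_α_le hi)
      have hdef := hU i hi
      have e' : U' i = M.stageMap P H t w U' i := stage_eq_stageMap M P H t w i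
      rw [e']
      unfold stageMap at hdef ⊢
      generalize fastIncrement H _ (P.jac t v) (P.F t v) (P.dt t v) _ _ _ _ = I at *
      generalize fastIncrement H _ (P.jac t w) (P.F t w) (P.dt t w) _ _ _ _ = I' at *
      have e : U i - (w + I') = (U i - (v + I)) + (v - w) + (I - I') := by abel
      rw [e]
      have n := norm_add₃_le (a := U i - (v + I)) (b := v - w) (c := I - I')
      have l := mul_le_mul_of_nonneg_right hS.lip (show 0 ≤ ‖v - w‖ + ε by positivity)
      linarith
  have hinc := norm_increment_sub_le hR hρ hB hS ht htH hv' hw' subset_rfl mU mU' hd0 hdiff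
    hS.pos.le le_rfl M.sum_abs_β_le
  rw [step_eq_updateMap]
  unfold updateMap
  rw [add_sub_add_comm]
  exact (norm_add_le _ _).trans (by gcongr; exact hinc.trans hsmall)

end

/-! ### Defects caused by the fast solvers -/

/-- The defect of a stage that is computed by a fast solver. -/
theorem norm_sub_stageMap_le [CompleteSpace X] {h : ℝ} (hB : 0 ≤ B) (hS : M.IsSmallStep X ρ B H)
    (hJ : ‖P.jac t v‖ ≤ B) {i : ℕ} (hi : i ∈ Finset.Icc 2 M.s) (hh : 0 ≤ h) (hhH : h ≤ H)
    {U : ℕ → X} {R : Micro X} {Ψ : Solver X} {q : ℕ} {K : ℝ}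
    (hR : R.IsRun Ψ (M.stageRHS P H t v U i) (M.c i * H) h v)
    (hO : R.HasOrder (M.stageRHS P H t v U i) q K) :
    ‖R.y R.N - M.stageMap P H t v U i‖ ≤ Real.exp (2 * B) * H * (|K| * h ^ q) := by
  have hc := M.c_pos i hi
  have hcH : M.c i * H ≤ H := mul_le_of_le_one_left hS.pos.le (M.c_le_one i hi)
  have hc0 : 0 ≤ M.c i * H := (mul_pos hc hS.pos).le
  have h := hR.norm_sub_le hO (J := P.jac t v) (g := fun τ => P.F t v - P.jac t v v +
      τ • P.dt t v + ∑ j ∈ Finset.Ico 2 i, (∑ k ∈ Finset.Icc 1 (M.ℓ i j),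
        M.α i j k / (M.c i ^ k * H ^ (k - 1) * ((k - 1).factorial : ℝ)) * τ ^ (k - 1)) •
          M.diff P H t v j (U j))
    (fun τ y => by
      simp only [stageRHS, stagePoly, IVP.rem, add_smul]
      abel)
    (fastSolution_zero (P.jac t v) v (P.F t v) (P.dt t v) (Finset.Ico 2 i) (M.ℓ i) (M.α i)
      (fun j => M.diff P H t v j (U j)) H (M.c i))
    (hasDerivAt_fastSolution _ _ _ _ _ _ _ _ _ _) (show 0 ≤ 2 * B by positivity)
    (fun k h0 hk => hS.norm_exp _ hJ k h0 (hk.trans hhH))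
  rw [fastSolution_eq_add_fastIncrement _ _ _ _ _ _ _ _ hS.pos.ne' hc.ne'] at h
  refine h.trans (mul_le_mul_of_nonneg_right (mul_le_mul (Real.exp_le_exp.2 ?_) hcH hc0
    (Real.exp_pos _).le) (by positivity))
  exact mul_le_of_le_one_right (by positivity) (hcH.trans hS.le_one)

/-- The defect of an update that is computed by a fast solver. -/
theorem norm_sub_updateMap_le [CompleteSpace X] {h : ℝ} (hB : 0 ≤ B)
    (hS : M.IsSmallStep X ρ B H) (hJ : ‖P.jac t v‖ ≤ B) (hh : 0 ≤ h) (hhH : h ≤ H)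
    {U : ℕ → X} {R : Micro X} {Φ : Solver X} {r : ℕ} {K : ℝ}
    (hR : R.IsRun Φ (M.finalRHS P H t v U) H h v)
    (hO : R.HasOrder (M.finalRHS P H t v U) r K) :
    ‖R.y R.N - M.updateMap P H t v U‖ ≤ Real.exp (2 * B) * H * (|K| * h ^ r) := by
  -- The update is the fast equation with node `c = 1`; the factor `1 ^ k` matches the form of
  -- `fastSolution`.
  have h := hR.norm_sub_le hO (J := P.jac t v) (g := fun τ => P.F t v - P.jac t v v +
      τ • P.dt t v + ∑ j ∈ Finset.Icc 2 M.s, (∑ k ∈ Finset.Icc 1 (M.μ j),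
        M.β j k / (1 ^ k * H ^ (k - 1) * ((k - 1).factorial : ℝ)) * τ ^ (k - 1)) •
          M.diff P H t v j (U j))
    (fun τ y => by
      simp only [finalRHS, finalPoly, IVP.rem, add_smul, one_pow, one_mul]
      abel)
    (fastSolution_zero (P.jac t v) v (P.F t v) (P.dt t v) (Finset.Icc 2 M.s) M.μ M.β
      (fun j => M.diff P H t v j (U j)) H 1)
    (hasDerivAt_fastSolution _ _ _ _ _ _ _ _ _ _) (show 0 ≤ 2 * B by positivity)
    (fun k h0 hk => hS.norm_exp _ hJ k h0 (hk.trans hhH))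
  have e := fastSolution_eq_add_fastIncrement (P.jac t v) v (P.F t v) (P.dt t v)
    (Finset.Icc 2 M.s) M.μ M.β (fun j => M.diff P H t v j (U j)) hS.pos.ne' one_ne_zero
  rw [one_mul] at e
  rw [e] at h
  refine h.trans (mul_le_mul_of_nonneg_right (mul_le_mul_of_nonneg_right (Real.exp_le_exp.2 ?_)
    hS.pos.le) (by positivity))
  exact mul_le_of_le_one_right (by positivity) hS.le_one

end ExpRB

/-! ### Comparison of the two methods and the error bound -/

/-- The distance between the multirate and the underlying method. -/
theorem MERB.norm_sub_solution_le {X : Type*} [NormedAddCommGroup X] [NormedSpace ℝ X]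
    [CompleteSpace X] {M : ExpRB} {P : IVP X} {u : ℝ → X} {ρ B H h : ℝ}
    (hP : P.IsRegularAlong u ρ B) (hρ : ρ ≤ 1) (hB : 0 ≤ B) (hS : M.IsSmallStep X ρ B H)
    (hT : P.t₀ ≤ P.T) (hh : 0 ≤ h) (hhH : h ≤ H) {Ψ : ℕ → Solver X} {Φ : Solver X}
    (R : MERB M P Ψ Φ H h) {q r : ℕ} {Kq Kr : ℝ} (hq : R.StageOrder q Kq)
    (hr : R.FinalOrder r Kr)
    (hM : ∀ n : ℕ, P.t₀ + n * H ≤ P.T → ‖M.solution P H n - u (P.t₀ + n * H)‖ < ρ / 4)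
    {L g : ℝ} (hL : L = 3 * M.lipConst B)
    (hg : g = L * (Real.exp (2 * B) * H * (|Kq| * h ^ q)) + Real.exp (2 * B) * (|Kr| * h ^ r))
    (hε : Real.exp (2 * B) * H * (|Kq| * h ^ q) ≤ ρ / 4)
    (hgρ : (P.T - P.t₀) * Real.exp (L * (P.T - P.t₀)) * g ≤ ρ / 4) :
    ∀ n : ℕ, P.t₀ + n * H ≤ P.T →
      ‖R.u n - M.solution P H n‖ ≤ (P.T - P.t₀) * Real.exp (L * (P.T - P.t₀)) * g := by
  have hH := hS.pos
  have hL0 : 0 ≤ L := by rw [hL]; exact mul_nonneg (by norm_num) (M.lipConst_nonneg hB)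
  have hε0 : 0 ≤ Real.exp (2 * B) * H * (|Kq| * h ^ q) := by positivity
  have hg0 : 0 ≤ g := by rw [hg]; positivity
  have hmono : ∀ n : ℕ, P.t₀ + n * H ≤ P.T → n * H * Real.exp (L * (n * H)) * g ≤
      (P.T - P.t₀) * Real.exp (L * (P.T - P.t₀)) * g := fun n hn => by
    have h1 : n * H ≤ P.T - P.t₀ := by linarith
    have h2 : 0 ≤ P.T - P.t₀ := by linarith
    gcongr
  suffices key : ∀ n : ℕ, P.t₀ + n * H ≤ P.T →
      ‖R.u n - M.solution P H n‖ ≤ n * H * Real.exp (L * (n * H)) * g from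
    fun n hn => (key n hn).trans (hmono n hn)
  intro n
  induction n with
  | zero => intro _; simp [R.init, ExpRB.solution]
  | succ n ih =>
    intro hn
    push_cast at hn
    have hn' : P.t₀ + n * H ≤ P.T := by linarith
    have hnH : 0 ≤ n * H := by positivity
    set t := P.t₀ + n * H with ht_def
    have ht : t ∈ Icc P.t₀ P.T := ⟨by linarith, hn'⟩
    have htH : t + H ∈ Icc P.t₀ P.T := ⟨by linarith, by linarith⟩
    have he := ih hn'
    have hw := hM n hn'
    have hvw := (he.trans (hmono n hn')).trans hgρ
    -- Bootstrap: the bound already proved at `n` and the convergence of the underlying method cost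
    -- `ρ / 4` each, which leaves the multirate value where the stability estimate applies.
    have hv : ‖R.u n - u t‖ < ρ / 2 := by
      have := norm_sub_le_norm_sub_add_norm_sub (R.u n) (M.solution P H n) (u t)
      linarith
    have hρ0 : 0 < ρ := by linarith [(norm_nonneg _).trans_lt hw]
    have hJ := hP.norm_jac t (R.u n) ⟨ht, show ‖R.u n - u t‖ < ρ by linarith⟩
    have hstage : ∀ i ∈ Finset.Icc 2 M.s, ‖R.U n i - M.stageMap P H t (R.u n) (R.U n) i‖ ≤
        Real.exp (2 * B) * H * (|Kq| * h ^ q) := fun i hi => by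
      rw [R.stage_eq n hn i hi]
      exact ExpRB.norm_sub_stageMap_le hB hS hJ hi hh hhH (R.isRun_stage n hn i hi) (hq n hn i hi)
    have hfinal := ExpRB.norm_sub_updateMap_le hB hS hJ hh hhH (R.isRun_final n hn) (hr n hn)
    rw [← R.final_eq n hn] at hfinal
    have hstab := ExpRB.norm_updateMap_sub_le hP hρ hB hS ht htH hv (w := M.solution P H n)
      (by linarith) hε0 hε hstage
    have hsucc : M.solution P H (n + 1) = M.step P H t (M.solution P H n) := rfl
    rw [hsucc]
    have htri := norm_sub_le_norm_sub_add_norm_sub (R.u (n + 1))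
      (M.updateMap P H t (R.u n) (R.U n)) (M.step P H t (M.solution P H n))
    have hexp : 1 + L * H ≤ Real.exp (L * H) := by
      have := Real.add_one_le_exp (L * H); linarith
    have hone : 1 ≤ Real.exp (L * ((n + 1) * H)) := Real.one_le_exp (by positivity)
    push_cast
    -- Gronwall recursion `δ' ≤ (1 + L H) δ + H g`: the first part of `g` is `L` times the stage
    -- defect, the second the update defect divided by `H`.
    calc ‖R.u (n + 1) - M.step P H t (M.solution P H n)‖
        ≤ (1 + L * H) * ‖R.u n - M.solution P H n‖ + H * g := by
          rw [hg, hL]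
          linarith
      _ ≤ Real.exp (L * H) * (n * H * Real.exp (L * (n * H)) * g) +
          Real.exp (L * ((n + 1) * H)) * (H * g) := by
          refine add_le_add ?_ (le_mul_of_one_le_left (by positivity) hone)
          gcongr
      _ = _ := by
          rw [show L * ((n + 1) * H) = L * H + L * (n * H) by ring, Real.exp_add]
          ring

theorem MERB.exists_error_bound {X : Type*} [NormedAddCommGroup X] [NormedSpace ℝ X]
    [CompleteSpace X] (P : IVP X) (hT : P.t₀ < P.T) (u : ℝ → X) (hu : P.IsSolution u)
    (K : ℕ) (hK : 2 ≤ K) (hsmooth : P.IsSmoothAlong u K)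
    (M : ExpRB) (p q r : ℕ) (hp : 1 ≤ p) (hr : 1 ≤ r) (hM : M.HasGlobalOrder P u p) :
    ∃ C₁ : ℝ, ∀ Kq Kr : ℝ, ∃ C₂ C₃ H₀ : ℝ, 0 < H₀ ∧
      ∀ (H : ℝ) (m : ℕ), 0 < H → H ≤ H₀ → 1 ≤ m →
      ∀ (Ψ : ℕ → Solver X) (Φ : Solver X) (R : MERB M P Ψ Φ H (H / m)),
        R.StageOrder q Kq → R.FinalOrder r Kr →
        ∀ n : ℕ, P.t₀ + n * H ≤ P.T →
          ‖R.u n - u (P.t₀ + n * H)‖ ≤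
            C₁ * H ^ p + C₂ * H * (H / m) ^ q + C₃ * (H / m) ^ r := by
  obtain ⟨ρ, B, hρ0, hρ, hB, hP⟩ := hsmooth.exists_isRegularAlong hK hT hu
  obtain ⟨C₁, Hc, hHc, hconv⟩ := hM
  refine ⟨C₁, fun Kq Kr => ?_⟩
  set L := 3 * M.lipConst B with hL
  have hL0 : 0 ≤ L := mul_nonneg (by norm_num) (M.lipConst_nonneg hB)
  set E := Real.exp (2 * B) with hE
  have hE0 : 0 ≤ E := (Real.exp_pos _).le
  set G := (P.T - P.t₀) * Real.exp (L * (P.T - P.t₀)) with hG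
  have hG0 : 0 ≤ G := mul_nonneg (by linarith) (Real.exp_pos _).le
  have hρ4 : 0 < ρ / 4 := by positivity
  obtain ⟨H₁, h₁, h₁'⟩ := ExpRB.exists_isSmallStep X M B hρ0
  obtain ⟨H₂, h₂, h₂'⟩ := ExpRB.exists_forall_mul_lt (E * |Kq|) hρ4
  obtain ⟨H₃, h₃, h₃'⟩ := ExpRB.exists_forall_mul_lt (G * (L * (E * |Kq|) + E * |Kr|)) hρ4
  obtain ⟨H₄, h₄, h₄'⟩ := ExpRB.exists_forall_mul_lt |C₁| hρ4
  -- `H₂`, `H₃`, `H₄` keep below `ρ / 4` the stage defect, the distance of the two methods and the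
  -- error of the underlying method, respectively.
  refine ⟨G * (L * (E * |Kq|)), G * (E * |Kr|), min (min H₁ H₂) (min (min H₃ H₄) Hc),
    by positivity, fun H m hH hle hm => ?_⟩
  simp only [le_min_iff] at hle
  obtain ⟨⟨l₁, l₂⟩, ⟨l₃, l₄⟩, l₅⟩ := hle
  have hS := h₁' H hH l₁
  have hH1 := hS.le_one
  have hm' : (1 : ℝ) ≤ m := by exact_mod_cast hm
  have hh0 : 0 ≤ H / m := by positivity
  have hhH : H / m ≤ H := div_le_self hH.le hm'
  -- From here on only `0 ≤ h ≤ H` is known, so all bounds are uniform in `m`.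
  generalize H / (m : ℝ) = h at hh0 hhH ⊢
  intro Ψ Φ R hq' hr' n hn
  have hhq : h ^ q ≤ 1 := pow_le_one₀ hh0 (hhH.trans hH1)
  have hhr : h ^ r ≤ H := (pow_le_of_le_one hh0 (hhH.trans hH1) (by omega)).trans hhH
  have hHp : H ^ p ≤ H := pow_le_of_le_one hH.le hH1 (by omega)
  have hε : E * H * (|Kq| * h ^ q) ≤ H * (E * |Kq|) := by
    calc E * H * (|Kq| * h ^ q) ≤ E * H * (|Kq| * 1) := by gcongr
      _ = _ := by ring
  have hdist := R.norm_sub_solution_le hP hρ hB hS hT.le hh0 hhH hq' hr'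
    (fun n hn => (hconv H hH l₅ n hn).trans_lt (by
      calc C₁ * H ^ p ≤ |C₁| * H ^ p := by gcongr; exact le_abs_self C₁
        _ ≤ |C₁| * H := by gcongr
        _ < ρ / 4 := by rw [mul_comm]; exact h₄' H hH l₄))
    hL rfl (hε.trans (h₂' H hH l₂).le) (by
      calc _ ≤ G * (L * (H * (E * |Kq|)) + E * (|Kr| * H)) := by
            rw [← hE, ← hG]; gcongr
        _ = H * (G * (L * (E * |Kq|) + E * |Kr|)) := by ring
        _ ≤ ρ / 4 := (h₃' H hH l₃).le) n hn
  have htri := norm_sub_le_norm_sub_add_norm_sub (R.u n) (M.solution P H n) (u (P.t₀ + n * H))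
  have hc := hconv H hH l₅ n hn
  rw [← hE, ← hG] at hdist
  linarith

theorem mainTheorem3 {X : Type*} [NormedAddCommGroup X] [NormedSpace ℝ X] [CompleteSpace X]
    (P : IVP X) (hT : P.t₀ < P.T) (u : ℝ → X) (hu : P.IsSolution u)
    (K : ℕ) (hK : 2 ≤ K) (hsmooth : P.IsSmoothAlong u K)
    (M : ExpRB) (p q r : ℕ) (hp : 1 ≤ p) (hr : 1 ≤ r) (hM : M.HasGlobalOrder P u p) :
    (∃ C₁ : ℝ, ∀ Kq Kr : ℝ, ∃ C₂ C₃ H₀ : ℝ, 0 < H₀ ∧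
      ∀ (H : ℝ) (m : ℕ), 0 < H → H ≤ H₀ → 1 ≤ m →
      ∀ (Ψ : ℕ → Solver X) (Φ : Solver X) (R : MERB M P Ψ Φ H (H / m)),
        R.StageOrder q Kq → R.FinalOrder r Kr →
        ∀ n : ℕ, P.t₀ + n * H ≤ P.T →
          ‖R.u n - u (P.t₀ + n * H)‖ ≤ C₁ * H ^ p + C₂ * H * (H / m) ^ q + C₃ * (H / m) ^ r) ∧
    (p ≤ q + 1 → p ≤ r → ∀ Kq Kr : ℝ, ∃ C H₀ : ℝ, 0 < H₀ ∧
      ∀ (H : ℝ) (m : ℕ), 0 < H → H ≤ H₀ → 1 ≤ m →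
      ∀ (Ψ : ℕ → Solver X) (Φ : Solver X) (R : MERB M P Ψ Φ H (H / m)),
        R.StageOrder q Kq → R.FinalOrder r Kr →
        ∀ n : ℕ, P.t₀ + n * H ≤ P.T →
          ‖R.u n - u (P.t₀ + n * H)‖ ≤ C * H ^ p) := by
  have main := MERB.exists_error_bound P hT u hu K hK hsmooth M p q r hp hr hM
  refine ⟨main, fun hpq hpr Kq Kr => ?_⟩
  obtain ⟨C₁, h⟩ := main
  obtain ⟨C₂, C₃, H₀, hH₀, h⟩ := h Kq Kr
  -- Absolute values are needed because the signs of `C₂` and `C₃` are not part of the first claim;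
  -- `H ≤ 1` allows exponents to be lowered.
  refine ⟨C₁ + |C₂| + |C₃|, min H₀ 1, by positivity, fun H m hH hle hm Ψ Φ R hq' hr' n hn => ?_⟩
  have hH1 : H ≤ 1 := hle.trans (min_le_right _ _)
  have hm' : (1 : ℝ) ≤ m := by exact_mod_cast hm
  have hh0 : 0 ≤ H / m := by positivity
  have hhH : H / m ≤ H := div_le_self hH.le hm'
  -- The extra factor `H` in front of the stage error is why stage order `p - 1` suffices.
  have hq2 : H * (H / m) ^ q ≤ H ^ p :=
    calc H * (H / m) ^ q ≤ H * H ^ q := by gcongr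
      _ = H ^ (q + 1) := by ring
      _ ≤ H ^ p := pow_le_pow_of_le_one hH.le hH1 hpq
  have hr2 : (H / m) ^ r ≤ H ^ p :=
    (pow_le_pow_left₀ hh0 hhH r).trans (pow_le_pow_of_le_one hH.le hH1 hpr)
  calc ‖R.u n - u (P.t₀ + n * H)‖
      ≤ C₁ * H ^ p + C₂ * H * (H / m) ^ q + C₃ * (H / m) ^ r :=
        h H m hH (hle.trans (min_le_left _ _)) hm Ψ Φ R hq' hr' n hn
    _ ≤ C₁ * H ^ p + |C₂| * (H * (H / m) ^ q) + |C₃| * (H / m) ^ r := by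
        rw [mul_assoc C₂]
        gcongr
        · exact le_abs_self C₂
        · exact le_abs_self C₃
    _ ≤ C₁ * H ^ p + |C₂| * H ^ p + |C₃| * H ^ p := by gcongr
    _ = _ := by ring
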